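/- **Setting.** Let $n\ge 1$, $N\ge 2$, $L\in[n]=\{1,\dots,n\}$. Let $\widehat W\in\mathbb R^{n\times n}$ be symmetric with eigenvalues $\lambda_1\ge\dots\ge\lambda_n\ge 0$ and $\lambda_1>0$, let $E\in\mathbb R^{n\times n}$ be symmetric, and let $\widetilde W=\widehat W+E$ have eigenvalues $\widetilde\lambda_1\ge\dots\ge\widetilde\lambda_n$. Write $x_+=\max\{x,0\}$ and let $\widetilde W^+$ be a symmetric matrix with eigenvalues $(\widetilde\lambda_1)_+,\dots,(\widetilde\lambda_n)_+$. Assume $(\widetilde\lambda_L)_+>0$. Let $\widehat W_L$ and $\widetilde W^+_L$ be best rank-$L$ approximations (in Frobenius norm) of $\widehat W$ and $\widetilde W^+$. Let $\|\cdot\|$ be the spectral norm, $\|\cdot\|_*$ the nuclear norm and $r(A)=\|A\|_*/\|A\|$ the effective rank. For a step size $\eta>0$ and $\alpha>0$ let $W_1(k),\dots,W_N(k)\in\mathbb R^{n\times n}$ follow gradient descent for $\widetilde{\mathcal L}(W_1,\dots,W_N)=\frac12\|W_N\cdots W_1-\widetilde W\|_F^2$, i.e. $W_j(0)=\alpha I$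 and $W_j(k+1)=W_j(k)-\eta\nabla_{W_j}\widetilde{\mathcal L}(W_1(k),\dots,W_N(k))$ for all $j$, and put $W(k)=W_N(k)\cdots W_1(k)$. Put $c_N=\frac{N-1}{2N-1}$ and let $\varepsilon\in(0,1)$. Assume $$\eta<\frac{1}{(3N-2)\max\{\alpha^{N-2},(\widetilde\lambda_1)_+^{2-2/N}\}}\qquad\text{and}\qquad \eta<\frac{1}{(3N-2)|\widetilde\lambda_i|^{2-2/N}}\ \text{ for every } i \text{ with } \widetilde\lambda_i<0 .$$ **Window.** Put $T_N^+(\lambda,\mu,\alpha)=\int_\alpha^\mu\frac{dy}{y^{N-1}(\lambda-y^N)}$ and $$T_N^{\mathrm{Id}}(\lambda,\delta,\alpha,\eta)=\frac1\eta T_N^+\big(\lambda,(c_N\lambda)^{1/N},\alpha\big)+\Big\lceil 1+(N-1)\Big(\frac{(c_N\lambda)^{1/N}}{\alpha}-1\Big)\Big\rceil+\frac{\ln(\lambda^{1/N}/\delta)-|\ln(1-c_N^{1/N})|}{|\ln(1-\eta N(c_N\lambda)^{2-2/N})|}.$$ Let $$\widetilde T_0=\max\Big\{T_N^{\mathrm{Id}}\big((\widetilde\lambda_1)_+,\tfrac12(\widetilde\lambda_1)_+,\alpha,\eta\big),\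 \max_{\ell\in[L]}T_N^{\mathrm{Id}}\big((\widetilde\lambda_\ell)_+,\tfrac{(\widetilde\lambda_\ell)_+^{1/N}}{4N}\varepsilon,\alpha,\eta\big)\Big\},$$ $$\widetilde T_1=\frac1\eta T_N^+\big((\widetilde\lambda_{L+1})_+,(\varepsilon'(\widetilde\lambda_{L+1})_+)^{1/N},\alpha\big)\quad\text{if } L<n \text{ and } (\widetilde\lambda_{L+1})_+>\alpha^N,$$ and $\widetilde T_1=+\infty$ otherwise. For $N=2$ and $\alpha^2<\lambda/3$ one has $$T_2^{\mathrm{Id}}(\lambda,\delta,\alpha,\eta)=\frac1{2\eta\lambda}\Big[\ln\Big(\frac{\lambda}{\alpha^2}-1\Big)-\ln2\Big]+\Big\lceil\sqrt{\frac{\lambda}{3}}\,\frac1\alpha\Big\rceil+\frac{\ln(\sqrt\lambda/\delta)-|\ln(1-\sqrt{1/3})|}{|\ln(1-2\eta\lambda/3)|},$$ and, with $\lambda=(\widetilde\lambda_{L+1})_+>\alpha^2$ and $\varepsilon'\in(0,1)$, $\widetilde T_1=\frac1{2\eta\lambda}\big[\ln(\frac{\lambda}{\alpha^2}-1)-\ln(\frac1{\varepsilon'}-1)\big]$.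 **Claim.** (a) Let $\varepsilon'\in(0,c_N)$, $\alpha^N<\varepsilon'(\widetilde\lambda_L)_+$ and $L'=\max\{\ell\in[n]:\varepsilon'(\widetilde\lambda_\ell)_+>\alpha^N\}$. Then for all integers $k\ge0$ with $k\in[\widetilde T_0,\widetilde T_1]$, $$\big|r(\widehat W_L)-r(W(k))\big|\le 2L\frac{\|E\|}{\lambda_1}+\varepsilon\, r(\widetilde W^+_L)+\frac{2(L'-L)}{c_N}\frac{(\widetilde\lambda_{L+1})_+}{(\widetilde\lambda_1)_+}\varepsilon'+(n-L')\frac{2\alpha^N}{\varepsilon'(\widetilde\lambda_1)_+}$$ (for $L=n$ the third term is $0$). (b) If $L<n$, $(\widetilde\lambda_{L+1})_+>0$ and $$\varepsilon'=c_N\min\Big\{\frac{(\widetilde\lambda_1)_+}{(\widetilde\lambda_{L+1})_+}\frac{\varepsilon\, r(\widetilde W^+_L)}{2(n-L)},1\Big\},\qquad \alpha=\min\Big\{(\varepsilon'(\widetilde\lambda_1)_+)^{1/N}\Big(\frac{\varepsilon\, r(\widetilde W^+_L)}{2(n-L)}\Big)^{1/N},(\varepsilon'(\widetilde\lambda_{L+1})_+)^{1/N}\Big\},$$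 then for all integers $k\ge0$ with $k\in[\widetilde T_0,\widetilde T_1]$, $$\big|r(\widehat W_L)-r(W(k))\big|\le 2L\frac{\|E\|}{\lambda_1}+3\varepsilon\, r(\widetilde W^+_L).$$ -/

import Mathlib

/-! Deep matrix factorization: gradient descent, effective rank, low-rank time window. -/

namespace DeepMF

open Matrix

noncomputable section

/-! ### Spectra, norms, effective rank, best rank-`L` approximation -/

/-- `lam 1 ≥ lam 2 ≥ ⋯ ≥ lam n` are the eigenvalues of the `n × n` matrix `A`, counted with
multiplicity. Only the values of `lam` at `1, …, n` are used. -/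
def HasSpectrum {n : ℕ} (A : Matrix (Fin n) (Fin n) ℝ) (lam : ℕ → ℝ) : Prop :=
  AntitoneOn lam (Set.Icc 1 n) ∧
    A.charpoly = ∏ i ∈ Finset.Icc 1 n, (Polynomial.X - Polynomial.C (lam i))

/-- The spectral (operator) norm `‖A‖` with respect to the Euclidean norm. -/
def specNorm {n : ℕ} (A : Matrix (Fin n) (Fin n) ℝ) : ℝ :=
  ‖Matrix.toEuclideanCLM (n := Fin n) (𝕜 := ℝ) A‖

/-- The nuclear norm `‖A‖_*`: the sum of the singular values. -/
def nuclearNorm {n : ℕ} (A : Matrix (Fin n) (Fin n) ℝ) : ℝ :=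
  ∑ i ∈ Finset.range n, (Matrix.toEuclideanLin A).singularValues i

/-- The effective rank `r(A) = ‖A‖_* / ‖A‖`. -/
def effRank {n : ℕ} (A : Matrix (Fin n) (Fin n) ℝ) : ℝ :=
  nuclearNorm A / specNorm A

/-- The Frobenius norm. -/
def frobNorm {n : ℕ} (A : Matrix (Fin n) (Fin n) ℝ) : ℝ :=
  √(∑ i, ∑ j, A i j ^ 2)

/-- `B` is a best rank-`L` approximation of `A` (in Frobenius norm, among all matrices of rank at
most `L`). -/
def IsBestRankApprox {n : ℕ} (L : ℕ) (A B : Matrix (Fin n) (Fin n) ℝ) : Prop :=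
  B.rank ≤ L ∧
    ∀ X : Matrix (Fin n) (Fin n) ℝ, X.rank ≤ L → frobNorm (A - B) ≤ frobNorm (A - X)

/-! ### Gradient descent on the factorized objective -/

/-- The product `W_N ⋯ W_1` of the factors; the factor `W_j` is `W ⟨j - 1, _⟩`. -/
def prodMat {n N : ℕ} (W : Fin N → Matrix (Fin n) (Fin n) ℝ) : Matrix (Fin n) (Fin n) ℝ :=
  (List.ofFn fun j : Fin N => W j.rev).prod

/-- The objective `½ ‖W_N ⋯ W_1 - T‖_F²` for the target `T`. -/
def loss {n N : ℕ} (T : Matrix (Fin n) (Fin n) ℝ) (W : Fin N → Matrix (Fin n) (Fin n) ℝ) : ℝ :=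
  1 / 2 * frobNorm (prodMat W - T) ^ 2

/-- The gradient of the objective with respect to the factor `j`: the matrix of the partial
derivatives with respect to the entries of that factor. -/
def lossGrad {n N : ℕ} (T : Matrix (Fin n) (Fin n) ℝ) (W : Fin N → Matrix (Fin n) (Fin n) ℝ)
    (j : Fin N) : Matrix (Fin n) (Fin n) ℝ :=
  Matrix.of fun a b =>
    deriv (fun t : ℝ => loss T (Function.update W j (W j + t • Matrix.single a b (1 : ℝ)))) 0

/-- The gradient descent iterates `(W_1(k), …, W_N(k))` for the target `T` with step size `η` and
initialization `W_j(0) = α I` for all `j`. -/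
def gdIter {n : ℕ} (N : ℕ) (T : Matrix (Fin n) (Fin n) ℝ) (η α : ℝ) :
    ℕ → Fin N → Matrix (Fin n) (Fin n) ℝ
  | 0 => fun _ => α • (1 : Matrix (Fin n) (Fin n) ℝ)
  | k + 1 => fun j => gdIter N T η α k j - η • lossGrad T (gdIter N T η α k) j

/-- The product iterate `W(k) = W_N(k) ⋯ W_1(k)`. -/
def gdProd {n : ℕ} (N : ℕ) (T : Matrix (Fin n) (Fin n) ℝ) (η α : ℝ) (k : ℕ) :
    Matrix (Fin n) (Fin n) ℝ :=
  prodMat (gdIter N T η α k)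

/-! ### The low-rank time window -/

/-- `c_N = (N - 1) / (2N - 1)`. -/
def cN (N : ℕ) : ℝ := ((N : ℝ) - 1) / (2 * (N : ℝ) - 1)

/-- `T_N^+(lam, μ, α) = ∫_α^μ dy / (y^(N-1) (lam - y^N))`: the time which the scalar gradient flow
`y' = y^(N-1) (lam - y^N)` needs to move from `α` to `μ`. -/
def flowTime (N : ℕ) (lam μ α : ℝ) : ℝ :=
  ∫ y in α..μ, 1 / (y ^ (N - 1) * (lam - y ^ N))

/-- `T_N^Id(lam, δ, α, η)` in the range `0 < α^N ≤ c_N lam`: the iteration count for accuracy `δ` of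
the scalar gradient descent started at `α`. -/
def TId (N : ℕ) (lam δ α η : ℝ) : ℝ :=
  1 / η * flowTime N lam ((cN N * lam) ^ (1 / (N : ℝ))) α
    + (⌈1 + ((N : ℝ) - 1) * ((cN N * lam) ^ (1 / (N : ℝ)) / α - 1)⌉ : ℝ)
    + (Real.log (lam ^ (1 / (N : ℝ)) / δ) - |Real.log (1 - cN N ^ (1 / (N : ℝ)))|)
        / |Real.log (1 - η * (N : ℝ) * (cN N * lam) ^ (2 - 2 / (N : ℝ)))|

/-- The left end `T_0` of the window, for the leading eigenvalues `lam 1, …, lam L`, `1 ≤ L`. -/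
def windowStart (N L : ℕ) (lam : ℕ → ℝ) (ε α η : ℝ) : ℝ :=
  max (TId N (lam 1) (lam 1 / 2) α η)
    (⨆ l : Fin L, TId N (lam (l + 1)) (lam (l + 1) ^ (1 / (N : ℝ)) / (4 * (N : ℝ)) * ε) α η)

/-- The right end `T_1` of the window, for the next eigenvalue `lamNext > α^N`. -/
def windowEnd (N : ℕ) (lamNext ε' α η : ℝ) : ℝ :=
  1 / η * flowTime N lamNext ((ε' * lamNext) ^ (1 / (N : ℝ))) α

/-- The iteration `k` lies in the window `[T_0, T_1]`. The formula for `T_1` makes sense only if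
there is an eigenvalue `lam (L + 1)` and it exceeds `α^N`; otherwise there is no right end. -/
def InWindow (N n L : ℕ) (lam : ℕ → ℝ) (ε ε' α η : ℝ) (k : ℕ) : Prop :=
  windowStart N L lam ε α η ≤ k ∧
    (L < n → α ^ N < lam (L + 1) → (k : ℝ) ≤ windowEnd N (lam (L + 1)) ε' α η)

end

end DeepMF

namespace DeepMF

/-! ### Scalar gradient descent -/

/-! All factors start at `α I`, so they remain equal, symmetric and commuting with the target. At
such a point every partial gradient is `X ^ (N - 1) * (X ^ N - T)` (`lossGrad_const`). In an
eigenbasis of the target, descent therefore splits into scalar recursions `x ↦ x + η * x ^ (N - 1) *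
(λ - x ^ N)` started at `α`, one per eigenvalue (`gdProd_conj_diagonal`). The effective rank of
`W(k)` is then the sum of the `N`-th powers of the scalar iterates divided by their maximum.

The window comes from comparing a recursion with its gradient flow. The velocity increases as long
as `y ^ N ≤ c_N λ`, so there an explicit Euler step lags behind the flow. Hence before the right end
the tail iterates still have `N`-th power at most `ε' λ_{L+1}` (`scalarGD_pow_le_of_le_windowEnd`).
The lag costs at most `(N - 1) (x - α) / α` steps, and beyond `(c_N λ) ^ (1 / N)` convergence is
linear. So after the left end the leading entries lie between `(1 - ε / 4) λ` and `λ`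
(`le_scalarGD_of_TId_le`).

On the matrix side, a best rank-`L` approximation of a positive semidefinite matrix has effective
rank `(λ_1 + ⋯ + λ_L) / λ_1`, even when ties make it non-unique (`effRank_of_isBestRankApprox`).
Weyl's inequality compares this ratio for the unperturbed spectrum with the one for the positive
part of the perturbed spectrum. The triangle inequality through the latter ratio gives the noise
term, the `ε` term and the tail. -/

/-- Gradient descent for `½ (x ^ N - lam) ^ 2 / N`, started at `α`. -/
noncomputable def scalarGD (N : ℕ) (lam η α : ℝ) : ℕ → ℝ
  | 0 => α
  | k + 1 => scalarGD N lam η α k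
      - η * (scalarGD N lam η α k ^ (N - 1) * (scalarGD N lam η α k ^ N - lam))

/-- The velocity `y ^ (N - 1) * (lam - y ^ N)` of the scalar gradient flow. -/
def velocity (N : ℕ) (lam y : ℝ) : ℝ := y ^ (N - 1) * (lam - y ^ N)

lemma scalarGD_succ (N : ℕ) (lam η α : ℝ) (k : ℕ) :
    scalarGD N lam η α (k + 1) =
      scalarGD N lam η α k + η * velocity N lam (scalarGD N lam η α k) := by
  simp only [scalarGD, velocity]; ring

lemma pow_sub_pow_le {a b : ℝ} (ha : 0 ≤ a) (hab : a ≤ b) (N : ℕ) :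
    b ^ N - a ^ N ≤ N * b ^ (N - 1) * (b - a) := by
  rw [← (Commute.all b a).geom_sum₂_mul N]
  refine mul_le_mul_of_nonneg_right ?_ (sub_nonneg.2 hab)
  have h : ∀ i ∈ Finset.range N, b ^ i * a ^ (N - 1 - i) ≤ b ^ (N - 1) := fun i hi => by
    have : i + (N - 1 - i) = N - 1 := by have := Finset.mem_range.1 hi; omega
    calc b ^ i * a ^ (N - 1 - i) ≤ b ^ i * b ^ (N - 1 - i) := by have := ha.trans hab; gcongr
      _ = b ^ (N - 1) := by rw [← pow_add, this]
  simpa using Finset.sum_le_card_nsmul _ _ _ h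

lemma le_pow_sub_pow {a b : ℝ} (ha : 0 ≤ a) (hab : a ≤ b) (N : ℕ) :
    N * a ^ (N - 1) * (b - a) ≤ b ^ N - a ^ N := by
  rw [← (Commute.all b a).geom_sum₂_mul N]
  refine mul_le_mul_of_nonneg_right ?_ (sub_nonneg.2 hab)
  have h : ∀ i ∈ Finset.range N, a ^ (N - 1) ≤ b ^ i * a ^ (N - 1 - i) := fun i hi => by
    have : i + (N - 1 - i) = N - 1 := by have := Finset.mem_range.1 hi; omega
    calc a ^ (N - 1) = a ^ i * a ^ (N - 1 - i) := by rw [← pow_add, this]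
      _ ≤ b ^ i * a ^ (N - 1 - i) := by gcongr
  simpa using Finset.card_nsmul_le_sum _ _ _ h

/-- The gap satisfies `s ^ N - x ^ N ≤ N s ^ (N - 1) (s - x)`, so a small step covers at most the
distance to the fixed point `s` and cannot overshoot. -/
lemma step_mem_of_le {N : ℕ} {s η x : ℝ} (hη : 0 ≤ η) (hx : 0 ≤ x) (hxs : x ≤ s)
    (h : η * N * (s ^ (N - 1)) ^ 2 ≤ 1) :
    x ≤ x + η * velocity N (s ^ N) x ∧ x + η * velocity N (s ^ N) x ≤ s := by
  have hs : 0 ≤ s := hx.trans hxs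
  have h1 : 0 ≤ s ^ N - x ^ N := sub_nonneg.2 (by gcongr)
  have h2 := pow_sub_pow_le hx hxs N
  unfold velocity
  constructor
  · have : 0 ≤ η * (x ^ (N - 1) * (s ^ N - x ^ N)) := by positivity
    linarith
  · have h3 : η * (x ^ (N - 1) * (s ^ N - x ^ N))
        ≤ η * (s ^ (N - 1) * (N * s ^ (N - 1) * (s - x))) := by gcongr
    have h4 : (s - x) * (η * N * (s ^ (N - 1)) ^ 2) ≤ (s - x) * 1 :=
      mul_le_mul_of_nonneg_left h (sub_nonneg.2 hxs)
    linarith [show η * (s ^ (N - 1) * (N * s ^ (N - 1) * (s - x)))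
      = (s - x) * (η * N * (s ^ (N - 1)) ^ 2) by ring]

lemma step_mem_of_ge {N : ℕ} {s η x A : ℝ} (hη : 0 ≤ η) (hs : 0 ≤ s) (hsx : s ≤ x) (hxA : x ≤ A)
    (h : η * N * (A ^ (N - 1)) ^ 2 ≤ 1) :
    s ≤ x + η * velocity N (s ^ N) x ∧ x + η * velocity N (s ^ N) x ≤ x := by
  have hx : 0 ≤ x := hs.trans hsx
  have hA : 0 ≤ A := hx.trans hxA
  have h1 : 0 ≤ x ^ N - s ^ N := sub_nonneg.2 (by gcongr)
  have h2 := pow_sub_pow_le hs hsx N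
  unfold velocity
  constructor
  · have h3 : η * (x ^ (N - 1) * (x ^ N - s ^ N))
        ≤ η * (A ^ (N - 1) * (N * A ^ (N - 1) * (x - s))) := by
      gcongr
      exact h2.trans (by have := sub_nonneg.2 hsx; gcongr)
    have h4 : (x - s) * (η * N * (A ^ (N - 1)) ^ 2) ≤ (x - s) * 1 :=
      mul_le_mul_of_nonneg_left h (sub_nonneg.2 hsx)
    linarith [show η * (A ^ (N - 1) * (N * A ^ (N - 1) * (x - s)))
      = (x - s) * (η * N * (A ^ (N - 1)) ^ 2) by ring]
  · have : 0 ≤ η * (x ^ (N - 1) * (x ^ N - s ^ N)) := by positivity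
    linarith

/-- For `lam ≤ 0` the iterate is pulled towards `0`. Since `N ≥ 2`, a factor `x` splits off the
velocity, and the remaining coefficient times `η` is at most `1`, so the step cannot cross zero. -/
lemma step_mem_of_neg {N : ℕ} (hN : 2 ≤ N) {lam η x A : ℝ} (hη : 0 ≤ η) (hx : 0 ≤ x) (hxA : x ≤ A)
    (hlam : lam ≤ 0) (h : η * (A ^ (N - 2) * (A ^ N - lam)) ≤ 1) :
    0 ≤ x + η * velocity N lam x ∧ x + η * velocity N lam x ≤ x := by
  unfold velocity
  have hA : 0 ≤ A := hx.trans hxA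
  have e : x ^ (N - 1) = x * x ^ (N - 2) := by rw [← pow_succ']; congr 1; omega
  constructor
  · have h1 : η * (x ^ (N - 2) * (x ^ N - lam)) ≤ 1 := by
      refine le_trans ?_ h
      have : 0 ≤ x ^ N - lam := by have := pow_nonneg hx N; linarith
      gcongr
    have := mul_le_mul_of_nonneg_left h1 hx
    rw [e]; linarith
  · have : 0 ≤ η * (x ^ (N - 1) * (x ^ N - lam)) := by
      have : 0 ≤ x ^ N - lam := by have := pow_nonneg hx N; linarith
      positivity
    linarith

lemma scalarGD_of_le {N : ℕ} {s η α : ℝ} (hη : 0 ≤ η) (hα : 0 ≤ α) (hαs : α ≤ s)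
    (h : η * N * (s ^ (N - 1)) ^ 2 ≤ 1) (k : ℕ) :
    α ≤ scalarGD N (s ^ N) η α k ∧ scalarGD N (s ^ N) η α k ≤ s := by
  induction k with
  | zero => exact ⟨le_rfl, hαs⟩
  | succ k ih =>
    rw [scalarGD_succ]
    have := step_mem_of_le hη (hα.trans ih.1) ih.2 h
    exact ⟨ih.1.trans this.1, this.2⟩

lemma scalarGD_monotone {N : ℕ} {s η α : ℝ} (hη : 0 ≤ η) (hα : 0 ≤ α) (hαs : α ≤ s)
    (h : η * N * (s ^ (N - 1)) ^ 2 ≤ 1) : Monotone (scalarGD N (s ^ N) η α) :=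
  monotone_nat_of_le_succ fun k => by
    have ih := scalarGD_of_le hη hα hαs h k
    rw [scalarGD_succ]
    exact (step_mem_of_le hη (hα.trans ih.1) ih.2 h).1

lemma scalarGD_of_ge {N : ℕ} {s η α : ℝ} (hη : 0 ≤ η) (hs : 0 ≤ s) (hsα : s ≤ α)
    (h : η * N * (α ^ (N - 1)) ^ 2 ≤ 1) (k : ℕ) :
    s ≤ scalarGD N (s ^ N) η α k ∧ scalarGD N (s ^ N) η α k ≤ α := by
  induction k with
  | zero => exact ⟨hsα, le_rfl⟩
  | succ k ih =>
    rw [scalarGD_succ]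
    have := step_mem_of_ge hη hs ih.1 ih.2 h
    exact ⟨this.1, this.2.trans ih.2⟩

lemma scalarGD_of_neg {N : ℕ} (hN : 2 ≤ N) {lam η α : ℝ} (hη : 0 ≤ η) (hα : 0 ≤ α)
    (hlam : lam ≤ 0) (h : η * (α ^ (N - 2) * (α ^ N - lam)) ≤ 1) (k : ℕ) :
    0 ≤ scalarGD N lam η α k ∧ scalarGD N lam η α k ≤ α := by
  induction k with
  | zero => exact ⟨hα, le_rfl⟩
  | succ k ih =>
    rw [scalarGD_succ]
    have := step_mem_of_neg hN hη ih.1 ih.2 hlam h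
    exact ⟨this.1, this.2.trans ih.2⟩

/-! ### Comparison of gradient descent with the gradient flow -/

lemma cN_pos {N : ℕ} (hN : 2 ≤ N) : 0 < cN N := by
  have : (2 : ℝ) ≤ N := by exact_mod_cast hN
  unfold cN
  apply div_pos <;> linarith

lemma cN_lt {N : ℕ} (hN : 2 ≤ N) : cN N < 1 / 2 := by
  have : (2 : ℝ) ≤ N := by exact_mod_cast hN
  unfold cN
  rw [div_lt_div_iff₀ (by linarith) (by norm_num)]; linarith

/-- The derivative is `y ^ (N - 2) * ((N - 1) lam - (2 N - 1) y ^ N)`; its sign change at `y ^ N =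
c_N lam` is the origin of `c_N`. -/
lemma velocity_monotoneOn {N : ℕ} (hN : 2 ≤ N) {lam b : ℝ} (hb : b ^ N ≤ cN N * lam) :
    MonotoneOn (velocity N lam) (Set.Icc 0 b) := by
  have hd : ∀ y, HasDerivAt (velocity N lam)
      (((N - 1 : ℕ) : ℝ) * y ^ (N - 1 - 1) * (lam - y ^ N)
        + y ^ (N - 1) * (0 - (N : ℝ) * y ^ (N - 1))) y := fun y =>
    (hasDerivAt_pow (N - 1) y).mul ((hasDerivAt_const y lam).sub (hasDerivAt_pow N y))
  refine monotoneOn_of_deriv_nonneg (convex_Icc 0 b)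
    (fun y _ => (hd y).continuousAt.continuousWithinAt)
    (fun y _ => (hd y).differentiableAt.differentiableWithinAt) fun y hy => ?_
  rw [interior_Icc] at hy
  rw [(hd y).deriv]
  obtain ⟨m, rfl⟩ := Nat.exists_eq_add_of_le' hN
  have hm : (0 : ℝ) ≤ m := Nat.cast_nonneg m
  have hy0 := hy.1
  have h1 : y ^ (m + 2) ≤ cN (m + 2) * lam := le_trans (by gcongr; exact hy.2.le) hb
  have h2 : (2 * (m : ℝ) + 3) * y ^ (m + 2) ≤ (m + 1) * lam := by
    have : cN (m + 2) = ((m : ℝ) + 1) / (2 * m + 3) := by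
      unfold cN; push_cast; congr 1 <;> ring
    rw [this, div_mul_eq_mul_div, le_div_iff₀ (by linarith)] at h1
    linarith
  simp only [show m + 2 - 1 = m + 1 by omega, show m + 1 - 1 = m by omega]
  push_cast
  have : 0 ≤ y ^ m * ((m + 1) * lam - (2 * (m : ℝ) + 3) * y ^ (m + 2)) :=
    mul_nonneg (by positivity) (by linarith)
  linarith [show ((m : ℝ) + 1) * y ^ m * (lam - y ^ (m + 2))
    + y ^ (m + 1) * (0 - ((m : ℝ) + 2) * y ^ (m + 1))
    = y ^ m * ((m + 1) * lam - (2 * (m : ℝ) + 3) * y ^ (m + 2)) by ring]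

lemma lt_of_le_cN_mul {N : ℕ} (hN : 2 ≤ N) {lam y : ℝ} (hy : 0 < y) (h : y ^ N ≤ cN N * lam) :
    y ^ N < lam := by
  have h0 := pow_pos hy N
  have hc := cN_pos hN
  have hl : 0 < lam := by
    by_contra hl
    nlinarith [mul_nonneg hc.le (sub_nonneg.2 (not_lt.1 hl))]
  nlinarith [cN_lt hN]

lemma velocity_pos {N : ℕ} {lam y : ℝ} (hy : 0 < y) (h : y ^ N < lam) : 0 < velocity N lam y :=
  mul_pos (pow_pos hy _) (sub_pos.2 h)

lemma continuousOn_inv_velocity {N : ℕ} {lam a b : ℝ} (ha : 0 < a) (hb : b ^ N < lam) :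
    ContinuousOn (fun y : ℝ => 1 / (y ^ (N - 1) * (lam - y ^ N))) (Set.Icc a b) := by
  refine continuousOn_const.div (by fun_prop) fun y hy => (velocity_pos (ha.trans_le hy.1) ?_).ne'
  exact lt_of_le_of_lt (by gcongr; exact (ha.trans_le hy.1).le; exact hy.2) hb

lemma flowTime_add {N : ℕ} {lam a b c : ℝ} (ha : 0 < a) (hab : a ≤ b) (hbc : b ≤ c)
    (hc : c ^ N < lam) : flowTime N lam b a + flowTime N lam c b = flowTime N lam c a := by
  have hb : b ^ N < lam := lt_of_le_of_lt (by gcongr; exact (ha.trans_le hab).le) hc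
  exact intervalIntegral.integral_add_adjacent_intervals
    ((continuousOn_inv_velocity ha hb).intervalIntegrable_of_Icc hab)
    ((continuousOn_inv_velocity (ha.trans_le hab) hc).intervalIntegrable_of_Icc hbc)

lemma flowTime_self (N : ℕ) (lam a : ℝ) : flowTime N lam a a = 0 :=
  intervalIntegral.integral_same

/-- On this range the velocity increases, so the integrand is largest at the left end. The bound is
the duration of an Euler step from `a` to `b`. -/
lemma flowTime_le {N : ℕ} (hN : 2 ≤ N) {lam a b : ℝ} (ha : 0 < a) (hab : a ≤ b)
    (hb : b ^ N ≤ cN N * lam) : flowTime N lam b a ≤ (b - a) / velocity N lam a := by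
  have hbl := lt_of_le_cN_mul hN (ha.trans_le hab) hb
  have h : ∀ y ∈ Set.Icc a b, 1 / (y ^ (N - 1) * (lam - y ^ N)) ≤ 1 / velocity N lam a :=
    fun y hy => one_div_le_one_div_of_le
      (velocity_pos ha (lt_of_le_of_lt (by gcongr) hbl))
      (velocity_monotoneOn hN hb ⟨ha.le, hab⟩ ⟨ha.le.trans hy.1, hy.2⟩ hy.1)
  have := intervalIntegral.integral_mono_on (μ := MeasureTheory.volume) hab
    ((continuousOn_inv_velocity ha hbl).intervalIntegrable_of_Icc hab)
    intervalIntegrable_const h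
  rw [intervalIntegral.integral_const, smul_eq_mul, mul_one_div] at this
  exact this

lemma le_flowTime {N : ℕ} (hN : 2 ≤ N) {lam a b : ℝ} (ha : 0 < a) (hab : a ≤ b)
    (hb : b ^ N ≤ cN N * lam) : (b - a) / velocity N lam b ≤ flowTime N lam b a := by
  have hb0 := ha.trans_le hab
  have hbl := lt_of_le_cN_mul hN hb0 hb
  have h : ∀ y ∈ Set.Icc a b, 1 / velocity N lam b ≤ 1 / (y ^ (N - 1) * (lam - y ^ N)) :=
    fun y hy => one_div_le_one_div_of_le
      (velocity_pos (ha.trans_le hy.1)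
        (lt_of_le_of_lt (by gcongr; exact (ha.trans_le hy.1).le; exact hy.2) hbl))
      (velocity_monotoneOn hN hb ⟨ha.le.trans hy.1, hy.2⟩ ⟨hb0.le, le_rfl⟩ hy.2)
  have := intervalIntegral.integral_mono_on (μ := MeasureTheory.volume) hab intervalIntegrable_const
    ((continuousOn_inv_velocity ha hbl).intervalIntegrable_of_Icc hab) h
  rw [intervalIntegral.integral_const, smul_eq_mul, mul_one_div] at this
  exact this

/-- A sequence that grows at most like gradient descent lags behind the gradient flow. -/
lemma le_of_mul_le_flowTime {N : ℕ} (hN : 2 ≤ N) {lam η α μ : ℝ} {x : ℕ → ℝ} (hα : 0 < α)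
    (hαμ : α ≤ μ) (hμ : μ ^ N ≤ cN N * lam) (h0 : x 0 = α) (hmono : Monotone x)
    (hstep : ∀ k, x (k + 1) ≤ x k + η * velocity N lam (x k)) (k : ℕ)
    (hk : η * k ≤ flowTime N lam μ α) (hη : 0 ≤ η) :
    x k ≤ μ ∧ flowTime N lam (x k) α ≤ η * k := by
  have hα' : ∀ k, α ≤ x k := fun k => h0 ▸ hmono (Nat.zero_le k)
  have hμl := lt_of_le_cN_mul hN (hα.trans_le hαμ) hμ
  induction k with
  | zero => simp [h0, hαμ, flowTime_self]
  | succ k ih =>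
    push_cast at hk ⊢
    obtain ⟨h1, h2⟩ := ih (by linarith)
    have hxk : 0 < x k := hα.trans_le (hα' k)
    have hv : 0 < velocity N lam (x k) := velocity_pos hxk (lt_of_le_of_lt (by gcongr) hμl)
    have hst : (x (k + 1) - x k) / velocity N lam (x k) ≤ η := by
      rw [div_le_iff₀ hv]; linarith [hstep k]
    -- If the step jumped over `μ`, the flow would get from `x k` to `μ` in time less than `η`,
    -- hence from `α` to `μ` in time less than `η (k + 1)`.
    have h3 : x (k + 1) ≤ μ := by
      by_contra! hlt
      have h4 := flowTime_add hα (hα' k) h1 hμl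
      have h5 := flowTime_le hN hxk h1 hμ
      have h6 : (μ - x k) / velocity N lam (x k) < (x (k + 1) - x k) / velocity N lam (x k) := by
        gcongr
      linarith
    have h4 : x (k + 1) ^ N ≤ μ ^ N := by
      gcongr; exact hα.le.trans (hα' _)
    have h5 := flowTime_add hα (hα' k) (hmono (Nat.le_succ k)) (h4.trans_lt hμl)
    have h6 := flowTime_le hN hxk (hmono (Nat.le_succ k)) (h4.trans hμ)
    exact ⟨h3, by linarith⟩

/-- As long as it has not reached `ν`, gradient descent loses at most
`(N - 1) (x k - α) / α` steps against the gradient flow. -/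
lemma mul_sub_le_flowTime {N : ℕ} (hN : 2 ≤ N) {lam η α : ℝ} {x : ℕ → ℝ} (hη : 0 ≤ η)
    (hα : 0 < α) (h0 : x 0 = α) (hmono : Monotone x)
    (hstep : ∀ k, x (k + 1) = x k + η * velocity N lam (x k)) (k : ℕ)
    (hk : x k ^ N ≤ cN N * lam) :
    η * (k - ((N : ℝ) - 1) * ((x k - α) / α)) ≤ flowTime N lam (x k) α := by
  have hα' : ∀ k, α ≤ x k := fun k => h0 ▸ hmono (Nat.zero_le k)
  induction k with
  | zero => simp [h0, flowTime_self]
  | succ k ih =>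
    have hle := hmono (Nat.le_succ k)
    have hxk : 0 < x k := hα.trans_le (hα' k)
    have hxk' : 0 < x (k + 1) := hα.trans_le (hα' _)
    have hl := lt_of_le_cN_mul hN hxk' hk
    have hp : x k ^ N ≤ x (k + 1) ^ N := by gcongr
    have h1 := ih (hp.trans hk)
    have h2 := flowTime_add hα (hα' k) hle hl
    have h3 := le_flowTime hN hxk hle hk
    have hv := velocity_pos hxk' hl
    have hN' : ((N - 1 : ℕ) : ℝ) = (N : ℝ) - 1 := by push_cast [Nat.cast_sub (by omega : 1 ≤ N)]; ring
    have hN1 : (0 : ℝ) ≤ (N : ℝ) - 1 := by rw [← hN']; positivity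
    -- The flow needs at least `η v(x k) / v(x (k + 1))` for this step. As `lam - y ^ N` decreases,
    -- the ratio is at least `(x k / x (k + 1)) ^ (N - 1)`, which Bernoulli linearizes. Replacing
    -- the denominator by `α` makes the losses telescope.
    have hratio : 1 - ((N : ℝ) - 1) * ((x (k + 1) - x k) / α)
        ≤ velocity N lam (x k) / velocity N lam (x (k + 1)) := by
      have b1 : 1 - ((N : ℝ) - 1) * ((x (k + 1) - x k) / x (k + 1)) ≤ (x k / x (k + 1)) ^ (N - 1) := by
        have := one_add_mul_le_pow (a := -((x (k + 1) - x k) / x (k + 1))) (by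
          rw [neg_le_neg_iff, div_le_iff₀ hxk']; linarith) (N - 1)
        rw [hN'] at this
        have e : 1 + -((x (k + 1) - x k) / x (k + 1)) = x k / x (k + 1) := by field_simp; ring
        rw [e] at this
        linarith
      have b2 : (x k / x (k + 1)) ^ (N - 1)
          ≤ velocity N lam (x k) / velocity N lam (x (k + 1)) := by
        rw [div_pow, div_le_div_iff₀ (by positivity) hv]
        unfold velocity
        have : x k ^ (N - 1) * x (k + 1) ^ (N - 1) * (lam - x (k + 1) ^ N) ≤
          x k ^ (N - 1) * x (k + 1) ^ (N - 1) * (lam - x k ^ N) := by gcongr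
        linarith
      have b3 : ((N : ℝ) - 1) * ((x (k + 1) - x k) / x (k + 1))
          ≤ ((N : ℝ) - 1) * ((x (k + 1) - x k) / α) := by
        have := sub_nonneg.2 hle
        gcongr
        exact hα' _
      linarith
    have h4 : (x (k + 1) - x k) / velocity N lam (x (k + 1))
        = η * (velocity N lam (x k) / velocity N lam (x (k + 1))) := by
      rw [hstep k]; ring
    have h5 := mul_le_mul_of_nonneg_left hratio hη
    have h6 : (x (k + 1) - α) / α = (x (k + 1) - x k) / α + (x k - α) / α := by ring
    rw [h6]; push_cast
    linarith

/-- Linear convergence of gradient descent once it has passed `ν`. -/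
lemma sub_scalarGD_le {N : ℕ} {η s ν : ℝ} {x : ℕ → ℝ} (hη : 0 ≤ η) (hν : 0 ≤ ν)
    (hx : ∀ k, x k ≤ s) (hmono : Monotone x)
    (hstep : ∀ k, x (k + 1) = x k + η * velocity N (s ^ N) (x k)) {K : ℕ} (hK : ν ≤ x K)
    (hq : η * N * (ν ^ (N - 1)) ^ 2 ≤ 1) (m : ℕ) :
    s - x (K + m) ≤ (s - ν) * (1 - η * N * (ν ^ (N - 1)) ^ 2) ^ m := by
  induction m with
  | zero => simp; linarith
  | succ m ih =>
    have hνx : ν ≤ x (K + m) := hK.trans (hmono (Nat.le_add_right K m))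
    have h1 := le_pow_sub_pow (hν.trans hνx) (hx (K + m)) N
    have h0 : 0 ≤ s - x (K + m) := sub_nonneg.2 (hx _)
    have h2 : η * (ν ^ (N - 1) * (N * ν ^ (N - 1) * (s - x (K + m))))
        ≤ η * velocity N (s ^ N) (x (K + m)) := by
      unfold velocity
      have h3 : N * ν ^ (N - 1) * (s - x (K + m)) ≤ s ^ N - x (K + m) ^ N :=
        le_trans (by gcongr) h1
      have : 0 ≤ N * ν ^ (N - 1) * (s - x (K + m)) := by positivity
      have := pow_nonneg (hν.trans hνx) (N - 1)
      gcongr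
    have h4 := mul_le_mul_of_nonneg_right ih (sub_nonneg.2 hq)
    rw [← add_assoc, hstep, pow_succ]
    linarith

/-! ### Real powers and the iteration count `TId` -/

lemma rpow_one_div_pow {N : ℕ} (hN : 2 ≤ N) {lam : ℝ} (h : 0 ≤ lam) :
    (lam ^ (1 / (N : ℝ))) ^ N = lam := by
  rw [one_div, Real.rpow_inv_natCast_pow h (by omega)]

lemma rpow_two_sub {N : ℕ} (hN : 2 ≤ N) {lam : ℝ} (h : 0 ≤ lam) :
    lam ^ (2 - 2 / (N : ℝ)) = ((lam ^ (1 / (N : ℝ))) ^ (N - 1)) ^ 2 := by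
  rw [← pow_mul, ← Real.rpow_natCast, ← Real.rpow_mul h]
  congr 1
  have : (N : ℝ) ≠ 0 := by positivity
  push_cast [Nat.cast_sub (by omega : 1 ≤ N)]
  field_simp

/-- Bernoulli gives `(1 - 1 / (4 N)) ^ N ≥ 3 / 4 > c_N`. This ensures that the accuracy `ε s / (4
N)` is finer than the gap left when the linear phase begins. -/
lemma cN_rpow_lt {N : ℕ} (hN : 2 ≤ N) : cN N ^ (1 / (N : ℝ)) < 1 - 1 / (4 * (N : ℝ)) := by
  have hN0 : (2 : ℝ) ≤ N := by exact_mod_cast hN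
  by_contra! h
  have h4 : 1 / (4 * (N : ℝ)) ≤ 1 := by rw [div_le_one (by linarith)]; linarith
  have h1 := one_add_mul_le_pow (a := -(1 / (4 * (N : ℝ)))) (by linarith) N
  have h2 : (1 + -(1 / (4 * (N : ℝ)))) ^ N ≤ (cN N ^ (1 / (N : ℝ))) ^ N :=
    pow_le_pow_left₀ (by linarith) (by linarith) N
  rw [rpow_one_div_pow hN (cN_pos hN).le] at h2
  have h3 : (N : ℝ) * -(1 / (4 * (N : ℝ))) = -(1 / 4) := by field_simp
  linarith [cN_lt hN]

/-- After `TId` steps scalar gradient descent is within relative accuracy `ε / (4 N)` of the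
fixed point. -/
lemma le_scalarGD_of_TId_le {N : ℕ} (hN : 2 ≤ N) {lam η α ε : ℝ} (hα : 0 < α) (hη : 0 < η)
    (hε : ε ∈ Set.Ioo (0 : ℝ) 1) (hαl : α ^ N ≤ cN N * lam)
    (hηN : η * N * lam ^ (2 - 2 / (N : ℝ)) ≤ 1 / 2) {k : ℕ}
    (hk : TId N lam (lam ^ (1 / (N : ℝ)) / (4 * (N : ℝ)) * ε) α η ≤ k) :
    lam * (1 - ε / 4) ≤ scalarGD N lam η α k ^ N := by
  obtain ⟨hε0, hε1⟩ := hε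
  have hN0 : (2 : ℝ) ≤ N := by exact_mod_cast hN
  have hc := cN_pos hN
  have hcl : 0 < cN N * lam := (pow_pos hα N).trans_le hαl
  have hlam : 0 < lam := pos_of_mul_pos_right hcl hc.le
  have hcl' : cN N * lam ≤ lam := by nlinarith [cN_lt hN]
  set s := lam ^ (1 / (N : ℝ)) with hs_def
  set ρ := cN N ^ (1 / (N : ℝ)) with hρ_def
  set ν := (cN N * lam) ^ (1 / (N : ℝ)) with hν_def
  have hs : 0 < s := Real.rpow_pos_of_pos hlam _
  have hρ : 0 < ρ := Real.rpow_pos_of_pos hc _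
  have hν : 0 < ν := Real.rpow_pos_of_pos hcl _
  have hsN : s ^ N = lam := rpow_one_div_pow hN hlam.le
  have hνN : ν ^ N = cN N * lam := rpow_one_div_pow hN hcl.le
  have hνs : ν = ρ * s := Real.mul_rpow hc.le hlam.le
  have hρ1 : ρ < 1 - 1 / (4 * (N : ℝ)) := cN_rpow_lt hN
  have hαν : α ≤ ν := le_of_pow_le_pow_left₀ (n := N) (by omega) hν.le (hνN ▸ hαl)
  have hνs' : ν ≤ s := le_of_pow_le_pow_left₀ (n := N) (by omega) hs.le (by rw [hνN, hsN]; exact hcl')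
  have hqs : η * N * (s ^ (N - 1)) ^ 2 ≤ 1 / 2 := by rw [rpow_two_sub hN hlam.le] at hηN; exact hηN
  unfold TId at hk
  rw [rpow_two_sub hN hcl.le, ← hν_def] at hk
  set q := η * N * (ν ^ (N - 1)) ^ 2 with hq_def
  have hq0 : 0 < q := by positivity
  have hq1 : q ≤ 1 / 2 := le_trans (by rw [hq_def]; gcongr) hqs
  set δ := s / (4 * (N : ℝ)) * ε with hδ_def
  have hδ : 0 < δ := by positivity
  have hδs : δ ≤ s * (1 - ρ) := by
    have h1 : s / (4 * (N : ℝ)) * ε ≤ s / (4 * (N : ℝ)) := mul_le_of_le_one_right (by positivity) hε1.le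
    have h2 : s * (1 / (4 * (N : ℝ))) ≤ s * (1 - ρ) := by gcongr; linarith
    rw [mul_one_div] at h2
    exact h1.trans h2
  have h1ρ : 0 < 1 - ρ := by have : 0 < 1 / (4 * (N : ℝ)) := by positivity
                             linarith
  have hlogρ : Real.log (1 - ρ) ≤ 0 := Real.log_nonpos h1ρ.le (by linarith)
  have hlogq : Real.log (1 - q) < 0 := Real.log_neg (by linarith) (by linarith)
  rw [abs_of_nonpos hlogρ, abs_of_neg hlogq, sub_neg_eq_add] at hk
  have hnum : 0 ≤ Real.log (s / δ) + Real.log (1 - ρ) := by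
    rw [← Real.log_mul (by positivity) h1ρ.ne']
    apply Real.log_nonneg
    rw [div_mul_eq_mul_div, le_div_iff₀ hδ]; linarith
  set t := (Real.log (s / δ) + Real.log (1 - ρ)) / -Real.log (1 - q) with ht_def
  have ht : 0 ≤ t := div_nonneg hnum (by linarith)
  have hB0 : 0 ≤ flowTime N lam ν α :=
    le_trans (div_nonneg (by linarith)
      (velocity_pos hν (lt_of_le_cN_mul hN hν hνN.le)).le) (le_flowTime hN hα hαν hνN.le)
  have hB1 : 0 ≤ ((N : ℝ) - 1) * (ν / α - 1) :=
    mul_nonneg (by linarith) (sub_nonneg.2 ((one_le_div hα).2 hαν))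
  have hm1 := Nat.le_ceil t
  have hm2 := Nat.ceil_lt_add_one ht
  set m := ⌈t⌉₊
  -- The iterations split into `K` for reaching `ν` and `m = ⌈t⌉₊` for linear convergence. The
  -- summand `1` inside the ceiling of `TId` pays for rounding `t` up.
  have hceil := Int.le_ceil (1 + ((N : ℝ) - 1) * (ν / α - 1))
  have hk' : 1 / η * flowTime N lam ν α + ((N : ℝ) - 1) * (ν / α - 1) + m < k := by linarith
  have hF : 0 ≤ 1 / η * flowTime N lam ν α := by positivity
  have hmk : m ≤ k := by exact_mod_cast (by linarith : (m : ℝ) ≤ k)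
  obtain ⟨K, rfl⟩ := Nat.exists_eq_add_of_le' hmk
  push_cast at hk'
  have hqs1 : η * N * (s ^ (N - 1)) ^ 2 ≤ 1 := by linarith
  have hmono := scalarGD_monotone hη.le hα.le (hαν.trans hνs') hqs1
  have hbd := scalarGD_of_le hη.le hα.le (hαν.trans hνs') hqs1
  rw [hsN] at hmono hbd
  -- Otherwise the lag estimate would bound `K` by the flow time to `ν` divided by `η`, plus `(N -
  -- 1) (ν / α - 1)`, contradicting `hk'`.
  have hK : ν ≤ scalarGD N lam η α K := by
    by_contra! hlt
    have hp : scalarGD N lam η α K ^ N ≤ cN N * lam := by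
      rw [← hνN]; have := hα.le.trans (hbd K).1; gcongr
    have h1 := mul_sub_le_flowTime hN hη.le hα rfl hmono (scalarGD_succ N lam η α) K hp
    have hνl := lt_of_le_cN_mul hN hν hνN.le
    have h2 := flowTime_add hα (hbd K).1 hlt.le hνl
    have h3 := le_flowTime hN (hα.trans_le (hbd K).1) hlt.le hνN.le
    have h4 : 0 ≤ (ν - scalarGD N lam η α K) / velocity N lam ν :=
      div_nonneg (by linarith) (velocity_pos hν hνl).le
    have h5 : η * (K - ((N : ℝ) - 1) * (ν / α - 1)) ≤ flowTime N lam ν α := by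
      refine le_trans ?_ (h1.trans (by linarith))
      have : (scalarGD N lam η α K - α) / α ≤ ν / α - 1 := by
        rw [sub_div, div_self hα.ne']; gcongr
      have : ((N : ℝ) - 1) * ((scalarGD N lam η α K - α) / α) ≤ ((N : ℝ) - 1) * (ν / α - 1) :=
        mul_le_mul_of_nonneg_left this (by linarith)
      gcongr
    rw [mul_comm, ← le_div_iff₀ hη] at h5
    have h6 : 1 / η * flowTime N lam ν α = flowTime N lam ν α / η := by ring
    linarith
  have hlin := sub_scalarGD_le hη.le hν.le (fun k => (hbd k).2) hmono
    (by rw [hsN]; exact scalarGD_succ N lam η α) hK (by linarith) m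
  rw [← hq_def] at hlin
  have hdec : (s - ν) * (1 - q) ^ m ≤ δ := by
    have e : s - ν = s * (1 - ρ) := by rw [hνs]; ring
    rw [e, ← Real.log_le_log_iff (by have := pow_pos (by linarith : 0 < 1 - q) m; positivity) hδ,
      Real.log_mul (by positivity) (pow_pos (by linarith) m).ne', Real.log_mul hs.ne' h1ρ.ne',
      Real.log_pow]
    rw [ht_def, div_le_iff₀ (by linarith), Real.log_div hs.ne' hδ.ne'] at hm1
    linarith
  have hfin : s * (1 - ε / (4 * N)) ≤ scalarGD N lam η α (K + m) := by
    have : s * (1 - ε / (4 * N)) = s - δ := by rw [hδ_def]; ring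
    linarith
  have hsmall : ε / (4 * (N : ℝ)) ≤ 1 := by rw [div_le_one (by linarith)]; linarith
  -- Bernoulli turns relative accuracy `ε / (4 N)` of the iterate into `ε / 4` of its `N`-th power.
  have hb := one_add_mul_le_pow (a := -(ε / (4 * (N : ℝ)))) (by linarith) N
  have hN3 : (N : ℝ) * -(ε / (4 * (N : ℝ))) = -(ε / 4) := by field_simp
  calc lam * (1 - ε / 4) ≤ s ^ N * (1 - ε / (4 * N)) ^ N := by
        rw [hsN]
        refine mul_le_mul_of_nonneg_left ?_ hlam.le
        rw [sub_eq_add_neg 1 (ε / (4 * (N : ℝ)))]; linarith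
    _ = (s * (1 - ε / (4 * N))) ^ N := (mul_pow _ _ _).symm
    _ ≤ _ := pow_le_pow_left₀ (mul_nonneg hs.le (by linarith)) hfin N

end DeepMF

namespace DeepMF

open Matrix
open scoped Matrix.Norms.L2Operator

/-! ### Spectral decomposition and orthogonal invariance -/

/-- Equal characteristic polynomials give equal sorted eigenvalues, hence the same diagonal form;
`U` is one eigenbasis composed with the inverse of the other. -/
lemma exists_orthogonal_conj_of_charpoly_eq {n : ℕ} {A B : Matrix (Fin n) (Fin n) ℝ}
    (hA : A.IsSymm) (hB : B.IsSymm) (h : A.charpoly = B.charpoly) :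
    ∃ U : Matrix (Fin n) (Fin n) ℝ, Uᵀ * U = 1 ∧ A = U * B * Uᵀ := by
  have hA' : A.IsHermitian := hA
  have hB' : B.IsHermitian := hB
  have he := (hA'.eigenvalues_eq_eigenvalues_iff hB').2 h
  have h1 := hA'.spectral_theorem
  have h2 := hB'.conjStarAlgAut_star_eigenvectorUnitary
  rw [he, ← h2, Unitary.conjStarAlgAut_apply, Unitary.conjStarAlgAut_apply] at h1
  set V : unitary (Matrix (Fin n) (Fin n) ℝ) := hA'.eigenvectorUnitary * star hB'.eigenvectorUnitary
  refine ⟨(V : Matrix (Fin n) (Fin n) ℝ), Unitary.coe_star_mul_self V, ?_⟩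
  rw [h1]
  change _ = (V : Matrix (Fin n) (Fin n) ℝ) * B * star (V : Matrix (Fin n) (Fin n) ℝ)
  simp [V, mul_assoc]

lemma HasSpectrum.exists_diagonal {n : ℕ} {A : Matrix (Fin n) (Fin n) ℝ} {lam : ℕ → ℝ}
    (h : HasSpectrum A lam) (hA : A.IsSymm) : ∃ U : Matrix (Fin n) (Fin n) ℝ,
      Uᵀ * U = 1 ∧ A = U * diagonal (fun i : Fin n => lam (i + 1)) * Uᵀ := by
  refine exists_orthogonal_conj_of_charpoly_eq hA (isSymm_diagonal _) ?_
  rw [h.2, charpoly_diagonal, Fin.prod_univ_eq_prod_range (fun i => Polynomial.X - Polynomial.C (lam (i + 1))) n,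
    Finset.range_eq_Ico, Finset.prod_Ico_add' (fun i => Polynomial.X - Polynomial.C (lam i)) 0 n 1]
  rfl

lemma HasSpectrum.antitone {n : ℕ} {A : Matrix (Fin n) (Fin n) ℝ} {lam : ℕ → ℝ}
    (h : HasSpectrum A lam) : Antitone fun i : Fin n => lam (i + 1) := fun i j hij =>
  h.1 ⟨by omega, by omega⟩ ⟨by omega, by omega⟩ (by simpa using hij)

lemma charpoly_conj {n : ℕ} {U : Matrix (Fin n) (Fin n) ℝ} (hU : Uᵀ * U = 1)
    (A : Matrix (Fin n) (Fin n) ℝ) : (U * A * Uᵀ).charpoly = A.charpoly := by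
  rw [charpoly_mul_comm, ← mul_assoc, hU, one_mul]

/-- A formula through the characteristic polynomial of `Aᵀ * A` makes orthogonal invariance and the
diagonal case algebraic. -/
lemma nuclearNorm_eq {n : ℕ} (A : Matrix (Fin n) (Fin n) ℝ) :
    nuclearNorm A = ((Aᵀ * A).charpoly.roots.map Real.sqrt).sum := by
  have hn : Module.finrank ℝ (EuclideanSpace ℝ (Fin n)) = n := finrank_euclideanSpace_fin
  have h1 : LinearMap.adjoint (toEuclideanLin A) ∘ₗ toEuclideanLin A = toEuclideanLin (Aᵀ * A) := by
    rw [← conjTranspose_eq_transpose_of_trivial, toLpLin_mul_same,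
      toEuclideanLin_conjTranspose_eq_adjoint]
  have h2 := (toEuclideanLin A).isSymmetric_adjoint_comp_self.roots_charpoly_eq_eigenvalues hn
  have h3 : (LinearMap.adjoint (toEuclideanLin A) ∘ₗ toEuclideanLin A).charpoly
      = (Aᵀ * A).charpoly := by
    exact h1 ▸ charpoly_toLin (Aᵀ * A) (PiLp.basisFun 2 ℝ (Fin n))
  rw [← h3, h2, nuclearNorm,
    ← Fin.sum_univ_eq_sum_range (fun i => (toEuclideanLin A).singularValues i) n]
  simp only [Multiset.map_map, LinearMap.singularValues_fin _ hn]
  rfl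

lemma nuclearNorm_conj {n : ℕ} {U : Matrix (Fin n) (Fin n) ℝ} (hU : Uᵀ * U = 1)
    (A : Matrix (Fin n) (Fin n) ℝ) : nuclearNorm (U * A * Uᵀ) = nuclearNorm A := by
  rw [nuclearNorm_eq, nuclearNorm_eq]
  have : (U * A * Uᵀ)ᵀ * (U * A * Uᵀ) = U * (Aᵀ * A) * Uᵀ := by
    simp only [transpose_mul, transpose_transpose, mul_assoc]
    rw [← mul_assoc Uᵀ U, hU, one_mul]
  rw [this, charpoly_conj hU]

lemma nuclearNorm_diagonal {n : ℕ} {d : Fin n → ℝ} (hd : ∀ i, 0 ≤ d i) :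
    nuclearNorm (diagonal d) = ∑ i, d i := by
  have h : (diagonal fun i => d i * d i).charpoly.roots
      = Finset.univ.val.map fun i => d i * d i := by
    rw [charpoly_diagonal]
    exact (Polynomial.roots_multiset_prod_X_sub_C (Finset.univ.val.map fun i => d i * d i)) ▸
      congrArg Polynomial.roots (by rw [Multiset.map_map]; rfl)
  rw [nuclearNorm_eq, diagonal_transpose, diagonal_mul_diagonal, h, Multiset.map_map]
  exact Finset.sum_congr rfl fun i _ => Real.sqrt_mul_self (hd i)

lemma specNorm_eq {n : ℕ} (A : Matrix (Fin n) (Fin n) ℝ) : specNorm A = ‖A‖ := rfl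

lemma specNorm_conj {n : ℕ} {U : Matrix (Fin n) (Fin n) ℝ} (hU : Uᵀ * U = 1)
    (A : Matrix (Fin n) (Fin n) ℝ) : specNorm (U * A * Uᵀ) = specNorm A := by
  have hU' : U ∈ unitary (Matrix (Fin n) (Fin n) ℝ) :=
    Unitary.mem_iff.2 ⟨hU, mul_eq_one_comm.1 hU⟩
  have hUt : Uᵀ ∈ unitary (Matrix (Fin n) (Fin n) ℝ) := Unitary.star_mem hU'
  rw [specNorm_eq, specNorm_eq, CStarRing.norm_mul_mem_unitary _ hUt,
    CStarRing.norm_mem_unitary_mul _ hU']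

lemma specNorm_diagonal {n : ℕ} (d : Fin n → ℝ) : specNorm (diagonal d) = ‖d‖ :=
  l2_opNorm_diagonal d

lemma effRank_conj {n : ℕ} {U : Matrix (Fin n) (Fin n) ℝ} (hU : Uᵀ * U = 1)
    (A : Matrix (Fin n) (Fin n) ℝ) : effRank (U * A * Uᵀ) = effRank A := by
  rw [effRank, effRank, nuclearNorm_conj hU, specNorm_conj hU]

lemma effRank_diagonal {n : ℕ} {d : Fin n → ℝ} (hd : ∀ i, 0 ≤ d i) :
    effRank (diagonal d) = (∑ i, d i) / ‖d‖ := by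
  rw [effRank, nuclearNorm_diagonal hd, specNorm_diagonal]

lemma nuclearNorm_of_posSemidef {n : ℕ} {A : Matrix (Fin n) (Fin n) ℝ} (hA : A.PosSemidef) :
    nuclearNorm A = A.trace := by
  obtain ⟨U, hU, h⟩ := exists_orthogonal_conj_of_charpoly_eq (A := A)
    (B := diagonal hA.1.eigenvalues) hA.1 (isSymm_diagonal _) (by
      rw [charpoly_diagonal, hA.1.charpoly_eq]; rfl)
  rw [h, nuclearNorm_conj hU, nuclearNorm_diagonal hA.eigenvalues_nonneg, trace_mul_comm,
    ← mul_assoc, hU, one_mul, trace_diagonal]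

/-! ### Weyl's inequality -/

lemma dotProduct_mulVec_le {n : ℕ} (E : Matrix (Fin n) (Fin n) ℝ) (x : Fin n → ℝ) :
    x ⬝ᵥ E *ᵥ x ≤ specNorm E * (x ⬝ᵥ x) := by
  have h1 := inner_toEuclideanCLM E (WithLp.toLp 2 x) (WithLp.toLp 2 x)
  have h2 := real_inner_le_norm (WithLp.toLp 2 x)
    (toEuclideanCLM (n := Fin n) (𝕜 := ℝ) E (WithLp.toLp 2 x))
  have h3 := (toEuclideanCLM (n := Fin n) (𝕜 := ℝ) E).le_opNorm (WithLp.toLp 2 x)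
  have h4 : x ⬝ᵥ x = ‖WithLp.toLp 2 x‖ ^ 2 := by
    rw [← real_inner_self_eq_norm_sq, EuclideanSpace.inner_eq_star_dotProduct]; rfl
  change inner ℝ _ _ = x ⬝ᵥ E *ᵥ x at h1
  rw [← h1, h4]
  calc _ ≤ _ := h2
    _ ≤ ‖WithLp.toLp 2 x‖ * (specNorm E * ‖WithLp.toLp 2 x‖) := by gcongr; exact h3
    _ = _ := by ring

lemma dotProduct_conj_diagonal {n : ℕ} (U : Matrix (Fin n) (Fin n) ℝ) (d x : Fin n → ℝ) :
    x ⬝ᵥ (U * diagonal d * Uᵀ) *ᵥ x = ∑ j, d j * (Uᵀ *ᵥ x) j ^ 2 := by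
  rw [← mulVec_mulVec, ← mulVec_mulVec, dotProduct_mulVec, ← mulVec_transpose]
  simp only [dotProduct, mulVec_diagonal]
  exact Finset.sum_congr rfl fun j _ => by ring

lemma dotProduct_self_conj {n : ℕ} {U : Matrix (Fin n) (Fin n) ℝ} (hU : Uᵀ * U = 1)
    (x : Fin n → ℝ) : x ⬝ᵥ x = ∑ j, (Uᵀ *ᵥ x) j ^ 2 := by
  have := dotProduct_conj_diagonal U (fun _ => 1) x
  simpa [mul_eq_one_comm.1 hU] using this

/-- By dimension count, the span of the columns `j ≤ i` of `V` contains a nonzero `x` orthogonal to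
the columns `j < i` of `U`. On this `x` the form with eigenvalues `b` is at least `b i * |x|²`, and
the one with eigenvalues `a` at most `a i * |x|²`. -/
lemma weyl_le {n : ℕ} {U V E : Matrix (Fin n) (Fin n) ℝ} {a b : Fin n → ℝ} (hU : Uᵀ * U = 1)
    (hV : Vᵀ * V = 1) (ha : Antitone a) (hb : Antitone b)
    (h : U * diagonal a * Uᵀ + E = V * diagonal b * Vᵀ) (i : Fin n) :
    b i ≤ a i + specNorm E := by
  let f : ({j : Fin n // j ≤ i} → ℝ) →ₗ[ℝ] ({j : Fin n // j < i} → ℝ) :=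
    ((Uᵀ * V).submatrix Subtype.val Subtype.val).mulVecLin
  have hlt : Module.finrank ℝ ({j : Fin n // j < i} → ℝ)
      < Module.finrank ℝ ({j : Fin n // j ≤ i} → ℝ) := by
    rw [Module.finrank_fintype_fun_eq_card, Module.finrank_fintype_fun_eq_card,
      Fintype.card_subtype, Fintype.card_subtype]
    refine Finset.card_lt_card ⟨fun j hj => ?_, fun hss => ?_⟩
    · simp at hj ⊢; exact hj.le
    · simpa using hss (Finset.mem_filter.2 ⟨Finset.mem_univ i, le_rfl⟩)
  obtain ⟨y, hy, hy0⟩ := (Submodule.ne_bot_iff _).1 (LinearMap.ker_ne_bot_of_finrank_lt (f := f) hlt)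
  let z : Fin n → ℝ := fun j => if hj : j ≤ i then y ⟨j, hj⟩ else 0
  have hz : ∀ j, i < j → z j = 0 := fun j hj => dif_neg (not_le.2 hj)
  have hUz : ∀ j, j < i → (Uᵀ *ᵥ (V *ᵥ z)) j = 0 := fun j hj => by
    have h1 := congrFun (LinearMap.mem_ker.1 hy) ⟨j, hj⟩
    rw [mulVec_mulVec]
    simp only [f, mulVecLin_apply, mulVec, dotProduct, submatrix_apply, Pi.zero_apply] at h1 ⊢
    have h2 : ∑ l, (Uᵀ * V) j l * z l = ∑ l with l ≤ i, (Uᵀ * V) j l * z l :=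
      (Finset.sum_filter_of_ne fun l _ hl => not_lt.1 fun h => hl (by rw [hz l h, mul_zero])).symm
    rw [← h1, h2, Finset.sum_subtype (p := fun l => l ≤ i) _ (by simp)]
    exact Finset.sum_congr rfl fun l _ => congrArg _ (dif_pos l.2)
  set x := V *ᵥ z
  have hVx : Vᵀ *ᵥ x = z := by rw [mulVec_mulVec, hV, one_mulVec]
  have hxx : 0 < x ⬝ᵥ x := by
    rw [dotProduct_self_conj hV, hVx]
    obtain ⟨j, hj⟩ := Function.ne_iff.1 hy0
    refine Finset.sum_pos' (fun _ _ => sq_nonneg _) ⟨j, Finset.mem_univ _, ?_⟩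
    have : z j = y j := dif_pos j.2
    rw [this]
    exact sq_pos_of_ne_zero hj
  have hb' : b i * (x ⬝ᵥ x) ≤ x ⬝ᵥ (V * diagonal b * Vᵀ) *ᵥ x := by
    rw [dotProduct_conj_diagonal, dotProduct_self_conj hV, Finset.mul_sum, hVx]
    refine Finset.sum_le_sum fun j _ => ?_
    rcases le_or_gt j i with hj | hj
    · have := hb hj; gcongr
    · simp [hz j hj]
  have ha' : x ⬝ᵥ (U * diagonal a * Uᵀ) *ᵥ x ≤ a i * (x ⬝ᵥ x) := by
    rw [dotProduct_conj_diagonal, dotProduct_self_conj hU, Finset.mul_sum]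
    refine Finset.sum_le_sum fun j _ => ?_
    rcases lt_or_ge j i with hj | hj
    · simp [hUz j hj]
    · have := ha hj; gcongr
  rw [← h, add_mulVec, dotProduct_add] at hb'
  have := dotProduct_mulVec_le E x
  nlinarith

lemma abs_sub_le_specNorm {n : ℕ} {A E : Matrix (Fin n) (Fin n) ℝ} {a b : ℕ → ℝ}
    (hA : A.IsSymm) (hE : E.IsSymm) (ha : HasSpectrum A a) (hb : HasSpectrum (A + E) b)
    (i : Fin n) : |b (i + 1) - a (i + 1)| ≤ specNorm E := by
  obtain ⟨U, hU, hAU⟩ := ha.exists_diagonal hA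
  obtain ⟨V, hV, hAV⟩ := hb.exists_diagonal (hA.add hE)
  have h1 := weyl_le hU hV ha.antitone hb.antitone (E := E) (by rw [← hAU, ← hAV]) i
  have h2 := weyl_le hV hU hb.antitone ha.antitone (E := -E) (by rw [← hAU, ← hAV]; simp) i
  have h3 : specNorm (-E) = specNorm E := by rw [specNorm_eq, specNorm_eq, norm_neg]
  rw [abs_le]; constructor <;> linarith

/-! ### Best rank-`L` approximations -/

lemma frobNorm_nonneg {n : ℕ} (A : Matrix (Fin n) (Fin n) ℝ) : 0 ≤ frobNorm A :=
  Real.sqrt_nonneg _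

lemma frobNorm_sq {n : ℕ} (A : Matrix (Fin n) (Fin n) ℝ) : frobNorm A ^ 2 = (Aᵀ * A).trace := by
  rw [frobNorm, Real.sq_sqrt (by positivity), Finset.sum_comm]
  simp [trace, mul_apply, sq]

lemma frobNorm_conj {n : ℕ} {U : Matrix (Fin n) (Fin n) ℝ} (hU : Uᵀ * U = 1)
    (A : Matrix (Fin n) (Fin n) ℝ) : frobNorm (U * A * Uᵀ) = frobNorm A := by
  have h : frobNorm (U * A * Uᵀ) ^ 2 = frobNorm A ^ 2 := by
    have : (U * A * Uᵀ)ᵀ * (U * A * Uᵀ) = U * (Aᵀ * A) * Uᵀ := by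
      simp only [transpose_mul, transpose_transpose, mul_assoc]
      rw [← mul_assoc Uᵀ U, hU, one_mul]
    rw [frobNorm_sq, frobNorm_sq, this, trace_mul_comm, ← mul_assoc, hU, one_mul]
  exact (pow_left_inj₀ (frobNorm_nonneg _) (frobNorm_nonneg _) two_ne_zero).1 h

lemma IsBestRankApprox.conj {n L : ℕ} {U A B : Matrix (Fin n) (Fin n) ℝ} (hU : Uᵀ * U = 1)
    (h : IsBestRankApprox L (U * A * Uᵀ) B) : IsBestRankApprox L A (Uᵀ * B * U) := by
  have hU' : U * Uᵀ = 1 := mul_eq_one_comm.1 hU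
  refine ⟨(rank_mul_le_left _ _).trans ((rank_mul_le_right _ _).trans h.1), fun X hX => ?_⟩
  have h1 := h.2 (U * X * Uᵀ) ((rank_mul_le_left _ _).trans ((rank_mul_le_right _ _).trans hX))
  have e1 : U * A * Uᵀ - U * X * Uᵀ = U * (A - X) * Uᵀ := by rw [mul_sub, sub_mul]
  have e2 : U * A * Uᵀ - B = U * (A - Uᵀ * B * U) * Uᵀ := by
    rw [mul_sub, sub_mul]
    congr 1
    calc B = (U * Uᵀ) * B * (U * Uᵀ) := by rw [hU', one_mul, mul_one]
      _ = _ := by simp only [mul_assoc]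
  rwa [e1, e2, frobNorm_conj hU, frobNorm_conj hU] at h1

lemma trace_eq_zero_of_frobNorm_le {n : ℕ} {C Y : Matrix (Fin n) (Fin n) ℝ}
    (h : ∀ t : ℝ, frobNorm C ≤ frobNorm (C - t • Y)) : (Cᵀ * Y).trace = 0 := by
  set a := (Cᵀ * Y).trace with ha
  set b := (Yᵀ * Y).trace with hb
  have hb0 : 0 ≤ b := by rw [hb, ← frobNorm_sq]; positivity
  have h1 : ∀ t : ℝ, 0 ≤ -(2 * t * a) + t ^ 2 * b := fun t => by
    have h2 := pow_le_pow_left₀ (frobNorm_nonneg _) (h t) 2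
    have h3 : (Yᵀ * C).trace = a := by
      rw [ha, ← trace_transpose (Cᵀ * Y), transpose_mul, transpose_transpose]
    rw [frobNorm_sq, frobNorm_sq, transpose_sub, transpose_smul, sub_mul, mul_sub, mul_sub] at h2
    simp only [trace_sub, Matrix.smul_mul, Matrix.mul_smul, trace_smul, smul_eq_mul] at h2
    rw [h3, ← ha, ← hb] at h2
    linarith
  -- The minimizer would be `a / b`; the shifted denominator is positive even if `b = 0`, and the
  -- value is still negative unless `a = 0`.
  have h2 := h1 (a / (b + 1))
  have h3 : -(2 * (a / (b + 1)) * a) + (a / (b + 1)) ^ 2 * b = -(a ^ 2 * (b + 2) / (b + 1) ^ 2) := by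
    field_simp; ring
  rw [h3] at h2
  by_contra ha0
  have : 0 < a ^ 2 * (b + 2) / (b + 1) ^ 2 := by positivity
  linarith

lemma eq_zero_of_trace_transpose_mul_self {n : ℕ} {A : Matrix (Fin n) (Fin n) ℝ}
    (h : (Aᵀ * A).trace = 0) : A = 0 := by
  rw [← conjTranspose_eq_transpose_of_trivial] at h
  exact trace_conjTranspose_mul_self_eq_zero_iff.1 h

/-- First-order optimality of a best rank-`L` approximation. -/
lemma IsBestRankApprox.first_order {n L : ℕ} {A B : Matrix (Fin n) (Fin n) ℝ}
    (h : IsBestRankApprox L A B) : (A - B) * Bᵀ = 0 ∧ Bᵀ * (A - B) = 0 := by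
  constructor
  · apply eq_zero_of_trace_transpose_mul_self
    -- Multiplying `B` on the left by `1 + t M` keeps the rank at most `L`. With `M = (A - B) * Bᵀ`
    -- the first variation is the squared Frobenius norm of `M`. The second claim uses right
    -- multiplication.
    rw [← trace_eq_zero_of_frobNorm_le (C := A - B) (Y := (A - B) * Bᵀ * B) fun t => ?_]
    · rw [transpose_mul, transpose_transpose, mul_assoc B, trace_mul_comm B]
      simp only [mul_assoc]
    · have e : A - B - t • ((A - B) * Bᵀ * B) = A - (1 + t • ((A - B) * Bᵀ)) * B := by
        rw [add_mul, one_mul, Matrix.smul_mul, sub_sub]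
      rw [e]
      exact h.2 _ ((rank_mul_le_right _ _).trans h.1)
  · apply eq_zero_of_trace_transpose_mul_self
    rw [← trace_eq_zero_of_frobNorm_le (C := A - B) (Y := B * (Bᵀ * (A - B))) fun t => ?_]
    · rw [transpose_mul, transpose_transpose]
      simp only [mul_assoc]
    · have e : A - B - t • (B * (Bᵀ * (A - B))) = A - B * (1 + t • (Bᵀ * (A - B))) := by
        rw [mul_add, mul_one, Matrix.mul_smul, sub_sub]
      rw [e]
      exact h.2 _ ((rank_mul_le_left _ _).trans h.1)

lemma trace_eq_rank_of_isIdempotentElem {n : ℕ} {P : Matrix (Fin n) (Fin n) ℝ} (h : P * P = P) :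
    P.trace = P.rank := by
  have h1 : IsIdempotentElem (toLin' P) := by
    rw [IsIdempotentElem, Module.End.mul_eq_comp, ← toLin'_mul, h]
  have h2 := (LinearMap.IsIdempotentElem.isProj_range _ h1).trace
  rwa [trace_toLin'_eq] at h2

/-- The equality case of Ky Fan's inequality, in terms of the diagonal `p` of a projection of rank
at most `L`. -/
lemma sum_eq_of_weights {n L : ℕ} (hL : 1 ≤ L) (hLn : L ≤ n) {d p : Fin n → ℝ} (hd : Antitone d)
    (hd0 : ∀ i, 0 ≤ d i) (hp0 : ∀ i, 0 ≤ p i) (hp1 : ∀ i, p i ≤ 1) (hp : ∑ i, p i ≤ L)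
    (h : ∑ i : Fin n, (if (i : ℕ) < L then d i ^ 2 else 0) ≤ ∑ i, d i ^ 2 * p i) :
    ∑ i, d i * p i = ∑ i : Fin n, (if (i : ℕ) < L then d i else 0) ∧
      (0 < d ⟨0, by omega⟩ → ∃ j, 0 < p j ∧ d j = d ⟨0, by omega⟩) := by
  set t := d ⟨L - 1, by omega⟩ with ht
  have ht0 : 0 ≤ t := hd0 _
  let χ : Fin n → ℝ := fun i => if (i : ℕ) < L then 1 else 0
  have hχL : ∑ i, χ i = L := by
    have : (Finset.univ.filter fun i : Fin n => (i : ℕ) < L).card = L := by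
      rw [Fin.card_filter_val_lt]; exact min_eq_right hLn
    simp only [χ, Finset.sum_boole, this]
  -- With the `L`-th largest value `t` as threshold, both factors change sign at the same place. The
  -- optimality hypothesis then forces every term to vanish, also with `d i - t` in place of `d i ^
  -- 2 - t ^ 2`.
  have hterm : ∀ i, 0 ≤ (d i ^ 2 - t ^ 2) * (χ i - p i) := fun i => by
    by_cases hi : (i : ℕ) < L
    · have h1 : t ≤ d i := hd (by rw [Fin.le_def]; simp only; omega)
      have : χ i = 1 := if_pos hi
      rw [this]
      exact mul_nonneg (sub_nonneg.2 (by gcongr)) (sub_nonneg.2 (hp1 i))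
    · have h1 : d i ≤ t := hd (by rw [Fin.le_def]; simp only; omega)
      have : χ i = 0 := if_neg hi
      rw [this, zero_sub]
      have h2 : d i ^ 2 ≤ t ^ 2 := pow_le_pow_left₀ (hd0 i) h1 2
      nlinarith [hp0 i]
  have hχd : ∀ e : Fin n → ℝ, ∑ i : Fin n, (if (i : ℕ) < L then e i else 0) = ∑ i, e i * χ i :=
    fun e => Finset.sum_congr rfl fun i _ => by simp [χ]
  have hsum : ∑ i, (d i ^ 2 - t ^ 2) * (χ i - p i) + t ^ 2 * (L - ∑ i, p i)
      = ∑ i, d i ^ 2 * χ i - ∑ i, d i ^ 2 * p i := by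
    rw [← hχL, ← Finset.sum_sub_distrib, Finset.mul_sum, ← Finset.sum_add_distrib,
      ← Finset.sum_sub_distrib]
    exact Finset.sum_congr rfl fun i _ => by ring
  rw [hχd fun i => d i ^ 2] at h
  have hS := Finset.sum_nonneg fun i (_ : i ∈ Finset.univ) => hterm i
  have hT : 0 ≤ t ^ 2 * (L - ∑ i, p i) := mul_nonneg (sq_nonneg t) (sub_nonneg.2 hp)
  have hT0 : t * (L - ∑ i, p i) = 0 := by
    have : t ^ 2 * (L - ∑ i, p i) = 0 := by linarith
    rcases mul_eq_zero.1 this with h | h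
    · rw [pow_eq_zero_iff two_ne_zero] at h; rw [h, zero_mul]
    · rw [h, mul_zero]
  have hS0 : ∀ i, (d i - t) * (χ i - p i) = 0 := fun i => by
    have h1 : ∑ i, (d i ^ 2 - t ^ 2) * (χ i - p i) = 0 := by linarith
    have h2 := (Finset.sum_eq_zero_iff_of_nonneg fun i _ => hterm i).1 h1 i (Finset.mem_univ i)
    rcases mul_eq_zero.1 h2 with h | h
    · rw [(pow_left_inj₀ (hd0 i) ht0 two_ne_zero).1 (sub_eq_zero.1 h), sub_self, zero_mul]
    · rw [h, mul_zero]
  constructor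
  · rw [hχd]
    have : ∑ i, (d i - t) * (χ i - p i) + t * (L - ∑ i, p i)
        = ∑ i, d i * χ i - ∑ i, d i * p i := by
      rw [← hχL, ← Finset.sum_sub_distrib, Finset.mul_sum, ← Finset.sum_add_distrib,
        ← Finset.sum_sub_distrib]
      exact Finset.sum_congr rfl fun i _ => by ring
    rw [Finset.sum_eq_zero fun i _ => hS0 i, hT0] at this
    linarith
  · intro hd1
    rcases (hp0 ⟨0, by omega⟩).lt_or_eq with h0 | h0
    · exact ⟨_, h0, rfl⟩
    -- If the first weight vanishes, then `d 0 = t`: the leading `L` values are tied, and any index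
    -- of positive weight attains the maximum.
    have h1 := hS0 ⟨0, by omega⟩
    have hχ0 : χ ⟨0, by omega⟩ = 1 := if_pos (by simp; omega)
    rw [hχ0, ← h0, sub_zero, mul_one, sub_eq_zero] at h1
    rw [← h1] at hT0
    have hL' : (1 : ℝ) ≤ L := by exact_mod_cast hL
    have h2 : 0 < ∑ i, p i := by
      have := (mul_eq_zero.1 hT0).resolve_left hd1.ne'
      linarith
    obtain ⟨j, -, hj⟩ := Finset.exists_lt_of_sum_lt (f := fun _ => (0 : ℝ)) (by simpa using h2)
    refine ⟨j, hj, ?_⟩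
    rcases mul_eq_zero.1 (hS0 j) with h3 | h3
    · rw [h1]; linarith
    · have h4 : (j : ℕ) < L := by
        by_contra h5
        have : χ j = 0 := if_neg h5
        linarith
      refine le_antisymm (hd (Nat.zero_le _)) ?_
      rw [h1]
      exact hd (by rw [Fin.le_def]; simp only; omega)

/-- With ties `B` need not be the diagonal truncation. The first-order conditions make it symmetric,
commuting with `D`, with `B * B = D * B`. So `B = D * P` for an orthogonal projection `P` of rank at
most `L`. Comparison with the truncation puts the diagonal of `P` in the equality case of Ky Fan,
which fixes trace and norm. -/
lemma effRank_of_isBestRankApprox_diagonal {n L : ℕ} (hL : 1 ≤ L) (hLn : L ≤ n) {d : Fin n → ℝ}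
    (hd : Antitone d) (hd0 : ∀ i, 0 ≤ d i) (hd1 : 0 < d ⟨0, by omega⟩)
    {B : Matrix (Fin n) (Fin n) ℝ} (hB : IsBestRankApprox L (diagonal d) B) :
    effRank B = (∑ i : Fin n, if (i : ℕ) < L then d i else 0) / d ⟨0, by omega⟩ := by
  obtain ⟨h1, h2⟩ := hB.first_order
  rw [sub_mul, sub_eq_zero] at h1
  rw [mul_sub, sub_eq_zero] at h2
  set D := diagonal d with hD
  have hDT : Dᵀ = D := diagonal_transpose d
  have h3 : B * D = B * Bᵀ := by simpa [hDT] using congrArg transpose h1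
  have h4 : D * B = Bᵀ * B := by simpa [hDT] using congrArg transpose h2
  have hcomm' : D * (D * B) = B * D * D := by
    rw [h4, ← mul_assoc, h1, h3, mul_assoc, mul_assoc, h2]
  -- Commuting with `D ^ 2` gives commuting with `D`, since nonnegative entries are determined by
  -- their squares.
  have hent : ∀ i j, d i * B i j = B i j * d j := fun i j => by
    have h5 := congrFun (congrFun hcomm' i) j
    simp only [hD, diagonal_mul, mul_diagonal] at h5
    by_cases hb : B i j = 0
    · simp [hb]
    have h6 : d i ^ 2 = d j ^ 2 := mul_right_cancel₀ hb (by linarith)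
    rw [(pow_left_inj₀ (hd0 i) (hd0 j) two_ne_zero).1 h6, mul_comm]
  have hcomm : D * B = B * D := by
    ext i j; simp only [hD, diagonal_mul, mul_diagonal, hent]
  have hcol : ∀ i j, d j = 0 → B i j = 0 := fun i j hj => by
    have h5 := congrFun (congrFun h4 j) j
    rw [hD, diagonal_mul, hj, zero_mul, mul_apply] at h5
    simp only [transpose_apply] at h5
    exact mul_self_eq_zero.1 ((Finset.sum_eq_zero_iff_of_nonneg
      fun i _ => mul_self_nonneg (B i j)).1 h5.symm i (Finset.mem_univ i))
  have hrow : ∀ i j, d i = 0 → B i j = 0 := fun i j hi => by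
    have h5 := congrFun (congrFun h3 i) i
    rw [hD, mul_diagonal, hi, mul_zero, mul_apply] at h5
    simp only [transpose_apply] at h5
    exact mul_self_eq_zero.1 ((Finset.sum_eq_zero_iff_of_nonneg
      fun j _ => mul_self_nonneg (B i j)).1 h5.symm j (Finset.mem_univ j))
  have hsymm : Bᵀ = B := by
    have h5 : D * B = D * Bᵀ := by rw [h1, ← h3, hcomm]
    ext i j
    have h6 := congrFun (congrFun h5 i) j
    simp only [hD, diagonal_mul, transpose_apply] at h6 ⊢
    by_cases hi : d i = 0
    · rw [hrow i j hi, hcol j i hi]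
    · exact (mul_left_cancel₀ hi h6).symm
  have hBB : B * B = D * B := by rw [h4, hsymm]
  -- As `0⁻¹ = 0`, the diagonal factor is the pseudo-inverse of `D`.
  set P := diagonal (fun i => (d i)⁻¹) * B with hP
  have hPe : ∀ i j, P i j = (d i)⁻¹ * B i j := fun i j => by simp [hP, diagonal_mul]
  have hDP : D * P = B := by
    ext i j
    rw [hD, diagonal_mul, hPe]
    by_cases hi : d i = 0
    · simp [hi, hrow i j hi]
    · rw [mul_inv_cancel_left₀ hi]
  have hPB : P * B = B := by
    rw [hP, mul_assoc, hBB]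
    ext i j
    simp only [hD, diagonal_mul]
    by_cases hi : d i = 0
    · simp [hi, hrow i j hi]
    · rw [inv_mul_cancel_left₀ hi]
  have hPcomm : P = B * diagonal (fun i => (d i)⁻¹) := by
    ext i j
    rw [hPe, mul_diagonal]
    have := hent i j
    by_cases hi : d i = 0
    · simp [hrow i j hi]
    by_cases hj : d j = 0
    · simp [hcol i j hj]
    field_simp
    linarith
  have hPP : P * P = P := by
    nth_rewrite 2 [hPcomm]
    rw [← mul_assoc, hPB, ← hPcomm]
  have hPT : Pᵀ = P := by
    rw [hP, transpose_mul, hsymm, diagonal_transpose, ← hPcomm]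
  have hPii : ∀ i, P i i = ∑ j, P i j ^ 2 := fun i => by
    nth_rewrite 1 [← hPP]
    rw [mul_apply]
    refine Finset.sum_congr rfl fun j _ => ?_
    rw [sq, show P j i = P i j from congrFun (congrFun hPT i) j]
  have hp0 : ∀ i, 0 ≤ P i i := fun i => by rw [hPii]; positivity
  have hp1 : ∀ i, P i i ≤ 1 := fun i => by
    have h5 : P i i ^ 2 ≤ P i i := by
      nth_rewrite 2 [hPii]
      exact Finset.single_le_sum (f := fun j => P i j ^ 2) (fun j _ => sq_nonneg _)
        (Finset.mem_univ i)
    nlinarith [hp0 i]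
  have hptr : ∑ i, P i i ≤ L := by
    have h5 := trace_eq_rank_of_isIdempotentElem hPP
    have h6 : P.rank ≤ L := (rank_mul_le_right _ _).trans hB.1
    rw [show ∑ i, P i i = P.trace from rfl, h5]
    exact_mod_cast h6
  have hBii : ∀ i, B i i = d i * P i i := fun i => by
    nth_rewrite 1 [← hDP]; rw [hD, diagonal_mul]
  have hopt : ∑ i : Fin n, (if (i : ℕ) < L then d i ^ 2 else 0) ≤ ∑ i, d i ^ 2 * P i i := by
    let e : Fin n → ℝ := fun i => if (i : ℕ) < L then d i else 0
    have he : (diagonal e).rank ≤ L := by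
      rw [rank_diagonal, Fintype.card_subtype]
      calc _ ≤ (Finset.univ.filter fun i : Fin n => (i : ℕ) < L).card :=
            Finset.card_le_card fun i hi => by
              simp only [Finset.mem_filter, Finset.mem_univ, true_and, e] at hi ⊢
              by_contra h; exact hi (if_neg h)
        _ = L := by rw [Fin.card_filter_val_lt]; exact min_eq_right hLn
    have h5 := pow_le_pow_left₀ (frobNorm_nonneg _) (hB.2 _ he) 2
    rw [frobNorm_sq, frobNorm_sq, transpose_sub, hsymm, hDT, sub_mul, mul_sub, mul_sub, hBB,
      ← hcomm, hD, diagonal_sub, diagonal_transpose, diagonal_mul_diagonal, diagonal_mul_diagonal,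
      trace_diagonal, trace_sub, trace_sub, trace_diagonal] at h5
    have h6 : (diagonal d * B).trace = ∑ i, d i ^ 2 * P i i := by
      rw [trace]
      refine Finset.sum_congr rfl fun i _ => ?_
      rw [diag_apply, diagonal_mul, hBii]; ring
    have h7 : ∑ i, (d i - e i) * (d i - e i) =
        ∑ i, d i * d i - ∑ i : Fin n, (if (i : ℕ) < L then d i ^ 2 else 0) := by
      rw [← Finset.sum_sub_distrib]
      refine Finset.sum_congr rfl fun i _ => ?_
      simp only [e]; split_ifs <;> ring
    rw [h6, h7, sub_self, trace_zero, sub_zero] at h5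
    linarith
  obtain ⟨hsum, hex⟩ := sum_eq_of_weights hL hLn hd hd0 hp0 hp1 hptr hopt
  have hpsd : B.PosSemidef := by
    have h5 := (posSemidef_diagonal_iff.2 hd0).conjTranspose_mul_mul_same P
    rwa [conjTranspose_eq_transpose_of_trivial, hPT, mul_assoc, ← hD, hDP, hPB] at h5
  have hnuc : nuclearNorm B = ∑ i : Fin n, if (i : ℕ) < L then d i else 0 := by
    rw [nuclearNorm_of_posSemidef hpsd, ← hsum]
    exact Finset.sum_congr rfl fun i _ => hBii i
  have hspec : specNorm B = d ⟨0, by omega⟩ := by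
    rw [specNorm_eq]
    apply le_antisymm
    · have hPn : ‖P‖ ≤ 1 := by
        have h5 : ‖P‖ * ‖P‖ = ‖P‖ := by
          rw [← CStarRing.norm_star_mul_self]
          change ‖Pᵀ * P‖ = _
          rw [hPT, hPP]
        nlinarith [norm_nonneg P]
      have hDn : ‖D‖ ≤ d ⟨0, by omega⟩ := by
        rw [hD, l2_opNorm_diagonal]
        refine (pi_norm_le_iff_of_nonneg hd1.le).2 fun i => ?_
        rw [Real.norm_of_nonneg (hd0 i)]
        exact hd (Nat.zero_le _)
      calc ‖B‖ = ‖D * P‖ := by rw [hDP]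
        _ ≤ ‖D‖ * ‖P‖ := norm_mul_le _ _
        _ ≤ d ⟨0, by omega⟩ * 1 := by gcongr
        _ = _ := mul_one _
    · obtain ⟨j, hj, hdj⟩ := hex hd1
      -- The only possibly nonzero column of `F` is `P e_j`, an eigenvector of `B` for `d j`; it is
      -- nonzero because `P j j > 0`.
      set F := P * single j j (1 : ℝ) with hF
      have hF0 : F ≠ 0 := fun h0 => by
        have h5 := congrFun (congrFun h0 j) j
        simp [hF] at h5
        exact hj.ne' h5
      have hBF : B * F = d j • F := by
        have h5 : B * P = P * D := by
          have h6 : B * P = B := by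
            nth_rewrite 1 [← hDP]; rw [mul_assoc, hPP, hDP]
          rw [h6]
          ext a b
          rw [hD, mul_diagonal, hPe, mul_assoc, ← hent]
          by_cases ha : d a = 0
          · simp [ha, hrow a b ha]
          · rw [inv_mul_cancel_left₀ ha]
        rw [hF, ← mul_assoc, h5, mul_assoc, ← Matrix.mul_smul]
        congr 1
        ext a b
        rw [hD, diagonal_mul, Matrix.smul_apply, smul_eq_mul, single_apply]
        split_ifs with h
        · rw [h.1]
        · simp
      have h6 := norm_mul_le B F
      rw [hBF, norm_smul, Real.norm_of_nonneg (hd0 j)] at h6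
      rw [← hdj]
      exact le_of_mul_le_mul_right h6 (norm_pos_iff.2 hF0)
  rw [effRank, hnuc, hspec]

/-- The effective rank of a best rank-`L` approximation of a positive semidefinite matrix. -/
lemma effRank_of_isBestRankApprox {n L : ℕ} (hL : 1 ≤ L) (hLn : L ≤ n)
    {A B : Matrix (Fin n) (Fin n) ℝ} {lam : ℕ → ℝ} (hA : A.IsSymm) (h : HasSpectrum A lam)
    (h0 : ∀ i : Fin n, 0 ≤ lam (i + 1)) (h1 : 0 < lam 1) (hB : IsBestRankApprox L A B) :
    effRank B = (∑ i : Fin n, if (i : ℕ) < L then lam (i + 1) else 0) / lam 1 := by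
  obtain ⟨U, hU, hAU⟩ := h.exists_diagonal hA
  rw [hAU] at hB
  have hUt : Uᵀᵀ * Uᵀ = 1 := by rw [transpose_transpose]; exact mul_eq_one_comm.1 hU
  have h2 := effRank_of_isBestRankApprox_diagonal hL hLn h.antitone h0 h1 (hB.conj hU)
  have h3 := effRank_conj hUt B
  rw [transpose_transpose] at h3
  rw [← h3, h2]

end DeepMF

namespace DeepMF

open Matrix

/-! ### Gradient descent on commuting symmetric factors -/

lemma prod_ofFn_update_const {M : Type*} [Monoid M] (X Y : M) :
    ∀ {N : ℕ} (j : Fin N), (List.ofFn (Function.update (fun _ : Fin N => X) j Y)).prod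
      = X ^ (j : ℕ) * Y * X ^ (N - 1 - j)
  | 0, j => j.elim0
  | N + 1, j => by
    rw [List.ofFn_succ, List.prod_cons]
    refine Fin.cases ?_ (fun i => ?_) j
    · have : (fun i : Fin N => Function.update (fun _ : Fin (N + 1) => X) 0 Y i.succ) = fun _ => X := by
        ext i; simp
      rw [this]; simp [List.ofFn_const]
    · have : (fun l : Fin N => Function.update (fun _ : Fin (N + 1) => X) i.succ Y l.succ)
          = Function.update (fun _ => X) i Y := by
        ext l; simp [Function.update_apply]
      rw [this, prod_ofFn_update_const X Y i, Function.update_of_ne (Fin.succ_ne_zero i).symm,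
        Fin.val_succ, pow_succ', show N + 1 - 1 - (i + 1 : ℕ) = N - 1 - i by omega]
      simp only [mul_assoc]

lemma prodMat_update_const {n N : ℕ} (X Y : Matrix (Fin n) (Fin n) ℝ) (j : Fin N) :
    prodMat (Function.update (fun _ => X) j Y) = X ^ (N - 1 - j : ℕ) * Y * X ^ (j : ℕ) := by
  have h : (fun i : Fin N => Function.update (fun _ => X) j Y i.rev)
      = Function.update (fun _ => X) j.rev Y := by
    ext1 i
    by_cases hi : i = j.rev
    · subst hi; simp
    · rw [Function.update_of_ne hi, Function.update_of_ne fun h => hi (by rw [← h, Fin.rev_rev])]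
  rw [prodMat, h, prod_ofFn_update_const, Fin.val_rev]
  have := j.2
  congr 2
  · congr 1; omega
  · omega

lemma prodMat_const {n : ℕ} (N : ℕ) (X : Matrix (Fin n) (Fin n) ℝ) :
    prodMat (fun _ : Fin N => X) = X ^ N := by
  simp [prodMat, List.ofFn_const]

/-- Along one entry of one factor the product is affine in `t`, so the loss is quadratic and the
derivative is its linear coefficient. Commutation gathers the powers of `X` on the two sides, so the
result does not depend on `j`. -/
lemma lossGrad_const {n N : ℕ} {T X : Matrix (Fin n) (Fin n) ℝ} (hT : T.IsSymm) (hX : X.IsSymm)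
    (hc : Commute X T) (j : Fin N) :
    lossGrad T (fun _ => X) j = X ^ (N - 1) * (X ^ N - T) := by
  have hC : (X ^ N - T)ᵀ = X ^ N - T := by rw [transpose_sub, transpose_pow, hX, hT]
  have hXC : Commute X (X ^ N - T) := ((Commute.refl X).pow_right N).sub_right hc
  have hj := j.2
  ext a b
  set C := X ^ N - T with hCdef
  set Y := X ^ (N - 1 - j : ℕ) * single a b (1 : ℝ) * X ^ (j : ℕ) with hY
  have h1 : ∀ t : ℝ, loss T (Function.update (fun _ : Fin N => X) j (X + t • single a b (1 : ℝ)))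
      = 1 / 2 * (C.transpose * C).trace + t * (C.transpose * Y).trace
        + t ^ 2 * (1 / 2 * (Y.transpose * Y).trace) := fun t => by
    have h2 : prodMat (Function.update (fun _ : Fin N => X) j (X + t • single a b (1 : ℝ))) - T
        = C + t • Y := by
      rw [prodMat_update_const, mul_add, add_mul, Matrix.mul_smul, Matrix.smul_mul, ← hY,
        ← pow_succ, ← pow_add, hCdef, show N - 1 - (j : ℕ) + 1 + j = N by omega]
      abel
    have h3 : (Yᵀ * C).trace = (Cᵀ * Y).trace := by
      rw [← trace_transpose (Cᵀ * Y), transpose_mul Cᵀ, transpose_transpose]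
    rw [loss, h2, frobNorm_sq, transpose_add, transpose_smul, add_mul, mul_add, mul_add]
    simp only [trace_add, Matrix.smul_mul, Matrix.mul_smul, trace_smul, smul_eq_mul]
    rw [h3]
    ring
  have h4 : (Cᵀ * Y).trace = (X ^ (N - 1) * C) a b := by
    rw [hC, hY, ← mul_assoc, ← mul_assoc, trace_mul_comm, ← mul_assoc, ← mul_assoc, mul_assoc _ C,
      ← (hXC.pow_left _).eq, ← mul_assoc, ← pow_add, show (j : ℕ) + (N - 1 - j) = N - 1 by omega]
    have h5 : (X ^ (N - 1) * C)ᵀ = X ^ (N - 1) * C := by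
      rw [transpose_mul, hC, transpose_pow, hX, (hXC.pow_left _).eq]
    rw [← congrFun (congrFun h5 a) b, transpose_apply]
    simp [trace_mul_single]
  rw [← h4]
  simp only [lossGrad, of_apply, h1]
  have h6 : HasDerivAt (fun t : ℝ => 1 / 2 * (Cᵀ * C).trace + t * (Cᵀ * Y).trace
      + t ^ 2 * (1 / 2 * (Yᵀ * Y).trace)) _ 0 :=
    (((hasDerivAt_id (0 : ℝ)).mul_const _).const_add _).add ((hasDerivAt_pow 2 (0 : ℝ)).mul_const _)
  rw [h6.deriv]
  simp

lemma conj_mul_conj {n : ℕ} {U : Matrix (Fin n) (Fin n) ℝ} (hU : Uᵀ * U = 1)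
    (A B : Matrix (Fin n) (Fin n) ℝ) : U * A * Uᵀ * (U * B * Uᵀ) = U * (A * B) * Uᵀ := by
  simp only [mul_assoc]
  rw [← mul_assoc Uᵀ U, hU, one_mul]

lemma conj_pow {n : ℕ} {U : Matrix (Fin n) (Fin n) ℝ} (hU : Uᵀ * U = 1)
    (A : Matrix (Fin n) (Fin n) ℝ) (m : ℕ) : (U * A * Uᵀ) ^ m = U * A ^ m * Uᵀ := by
  induction m with
  | zero => rw [pow_zero, pow_zero, mul_one, mul_eq_one_comm.1 hU]
  | succ m ih => rw [pow_succ, ih, conj_mul_conj hU, ← pow_succ]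

lemma isSymm_conj {n : ℕ} (U : Matrix (Fin n) (Fin n) ℝ) {A : Matrix (Fin n) (Fin n) ℝ}
    (hA : A.IsSymm) : (U * A * Uᵀ).IsSymm := by
  rw [IsSymm, transpose_mul, transpose_mul, transpose_transpose, hA, mul_assoc]

/-- Gradient descent decouples into scalar gradient descents for the eigenvalues of the target. -/
lemma gdIter_conj_diagonal {n : ℕ} {U : Matrix (Fin n) (Fin n) ℝ} (hU : Uᵀ * U = 1) (N : ℕ)
    (τ : Fin n → ℝ) (η α : ℝ) (k : ℕ) :
    gdIter N (U * diagonal τ * Uᵀ) η α k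
      = fun _ => U * diagonal (fun i => scalarGD N (τ i) η α k) * Uᵀ := by
  induction k with
  | zero =>
    funext j
    have : diagonal (fun _ : Fin n => α) = α • (1 : Matrix (Fin n) (Fin n) ℝ) := by
      rw [smul_one_eq_diagonal]
    simp only [gdIter, scalarGD]
    rw [this, Matrix.mul_smul, Matrix.smul_mul, mul_one, mul_eq_one_comm.1 hU]
  | succ k ih =>
    funext j
    rw [gdIter, ih]
    beta_reduce
    rw [lossGrad_const (isSymm_conj U (isSymm_diagonal _))
      (isSymm_conj U (isSymm_diagonal _)), conj_pow hU, conj_pow hU, ← sub_mul, ← mul_sub,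
      conj_mul_conj hU, ← Matrix.smul_mul, ← Matrix.mul_smul, ← sub_mul, ← mul_sub]
    · congr 2
      rw [diagonal_pow, diagonal_pow, diagonal_sub, diagonal_mul_diagonal, ← diagonal_smul,
        diagonal_sub]
      rfl
    · rw [commute_iff_eq, conj_mul_conj hU, conj_mul_conj hU, (commute_diagonal _ _).eq]

lemma gdProd_conj_diagonal {n : ℕ} {U : Matrix (Fin n) (Fin n) ℝ} (hU : Uᵀ * U = 1) (N : ℕ)
    (τ : Fin n → ℝ) (η α : ℝ) (k : ℕ) :
    gdProd N (U * diagonal τ * Uᵀ) η α k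
      = U * diagonal (fun i => scalarGD N (τ i) η α k ^ N) * Uᵀ := by
  rw [gdProd, gdIter_conj_diagonal hU, prodMat_const, conj_pow hU, diagonal_pow]
  rfl

/-! ### Effective rank estimates -/

lemma sum_ite_lt {n m : ℕ} (hm : m ≤ n) (c : ℝ) :
    ∑ i : Fin n, (if (i : ℕ) < m then c else 0) = m * c := by
  rw [← Finset.sum_filter, Finset.sum_const, Fin.card_filter_val_lt, min_eq_right hm, nsmul_eq_mul]

/-- Perturbation of the ratio of the sum of the leading entries to the first entry. -/
lemma abs_ratio_sub_ratio_le {n L : ℕ} (hLn : L ≤ n) {a b : Fin n → ℝ} {a₁ b₁ e : ℝ} (ha₁ : 0 < a₁)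
    (hb₁ : 0 < b₁) (hb0 : ∀ i, 0 ≤ b i) (hb : ∀ i, b i ≤ b₁) (h : ∀ i, |b i - a i| ≤ e)
    (h₁ : |b₁ - a₁| ≤ e) :
    |(∑ i : Fin n, if (i : ℕ) < L then a i else 0) / a₁
      - (∑ i : Fin n, if (i : ℕ) < L then b i else 0) / b₁| ≤ 2 * L * (e / a₁) := by
  set A := ∑ i : Fin n, if (i : ℕ) < L then a i else 0 with hA
  set B := ∑ i : Fin n, if (i : ℕ) < L then b i else 0 with hB
  have h2 : |A - B| ≤ L * e := by
    rw [← sum_ite_lt hLn, hA, hB, ← Finset.sum_sub_distrib]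
    refine (Finset.abs_sum_le_sum_abs _ _).trans (Finset.sum_le_sum fun i _ => ?_)
    split_ifs
    · rw [abs_sub_comm]; exact h i
    · simp
  have hB0 : 0 ≤ B := Finset.sum_nonneg fun i _ => by split_ifs; exacts [hb0 i, le_rfl]
  have hBL : B / b₁ ≤ L := by
    rw [div_le_iff₀ hb₁, ← sum_ite_lt hLn]
    refine Finset.sum_le_sum fun i _ => ?_
    split_ifs
    exacts [hb i, le_rfl]
  -- Separates the change of the sum from that of the denominator; as `B / b₁ ≤ L`, each costs at
  -- most `L * e / a₁`.
  have e1 : A / a₁ - B / b₁ = (A - B) / a₁ + B / b₁ * ((b₁ - a₁) / a₁) := by field_simp; ring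
  have he : 0 ≤ e := (abs_nonneg _).trans h₁
  rw [e1]
  calc _ ≤ |(A - B) / a₁| + |B / b₁ * ((b₁ - a₁) / a₁)| := abs_add_le _ _
    _ = |A - B| / a₁ + B / b₁ * (|b₁ - a₁| / a₁) := by
      rw [abs_div, abs_mul, abs_div (b₁ - a₁), abs_of_pos ha₁, abs_of_nonneg (by positivity : 0 ≤ B / b₁)]
    _ ≤ L * e / a₁ + L * (e / a₁) := by gcongr
    _ = _ := by ring

/-- The effective rank of a diagonal matrix whose leading entries are close to those of `b` and
whose remaining entries have sum at most `R`. -/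
lemma abs_ratio_sub_effRank_diagonal_le {n L : ℕ} (hn : 0 < n) (hL : 1 ≤ L) {b y : Fin n → ℝ}
    {ε R : ℝ} (hε : ε ∈ Set.Ioo (0 : ℝ) 1) (hb₁ : 0 < b ⟨0, hn⟩)
    (hy0 : ∀ i, 0 ≤ y i) (hy1 : ∀ i, y i ≤ b ⟨0, hn⟩)
    (hlow : ∀ i : Fin n, (i : ℕ) < L → b i * (1 - ε / 4) ≤ y i)
    (hup : ∀ i : Fin n, (i : ℕ) < L → y i ≤ b i)
    (hR : ∑ i : Fin n, (if (i : ℕ) < L then 0 else y i) ≤ R) :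
    |(∑ i : Fin n, if (i : ℕ) < L then b i else 0) / b ⟨0, hn⟩ - effRank (diagonal y)|
      ≤ ε * ((∑ i : Fin n, if (i : ℕ) < L then b i else 0) / b ⟨0, hn⟩)
        + 4 / 3 * (R / b ⟨0, hn⟩) := by
  obtain ⟨hε0, hε1⟩ := hε
  rw [effRank_diagonal hy0]
  set b₁ := b ⟨0, hn⟩ with hb₁_def
  set S := ∑ i : Fin n, if (i : ℕ) < L then b i else 0 with hS
  have hM1 : ‖y‖ ≤ b₁ := (pi_norm_le_iff_of_nonneg hb₁.le).2 fun i => by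
    rw [Real.norm_of_nonneg (hy0 i)]; exact hy1 i
  have hM0 : b₁ * (1 - ε / 4) ≤ ‖y‖ :=
    (hlow ⟨0, hn⟩ (by simp; omega)).trans ((le_abs_self _).trans (norm_le_pi_norm y ⟨0, hn⟩))
  have hb₁' : 0 < b₁ * (1 - ε / 4) := mul_pos hb₁ (by linarith)
  have hM : 0 < ‖y‖ := hb₁'.trans_le hM0
  have hsplit : ∑ i, y i = (∑ i : Fin n, if (i : ℕ) < L then y i else 0)
      + ∑ i : Fin n, if (i : ℕ) < L then 0 else y i := by
    rw [← Finset.sum_add_distrib]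
    exact Finset.sum_congr rfl fun i _ => by split_ifs <;> simp
  set Y := ∑ i : Fin n, if (i : ℕ) < L then y i else 0 with hY
  set R' := ∑ i : Fin n, if (i : ℕ) < L then 0 else y i with hR'
  have hR0 : 0 ≤ R' := Finset.sum_nonneg fun i _ => by split_ifs; exacts [le_rfl, hy0 i]
  have hYS : Y ≤ S := Finset.sum_le_sum fun i _ => by
    split_ifs with hi
    exacts [hup i hi, le_rfl]
  have hSY : S * (1 - ε / 4) ≤ Y := by
    rw [hS, Finset.sum_mul]
    refine Finset.sum_le_sum fun i _ => ?_
    split_ifs with hi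
    · exact hlow i hi
    · simp
  have hY0 : 0 ≤ Y := Finset.sum_nonneg fun i _ => by split_ifs; exacts [hy0 i, le_rfl]
  have hS0 : 0 ≤ S := hY0.trans hYS
  -- The sup norm of `y` may drop to `b₁ (1 - ε / 4)`. The inverse factor is bounded by `1 + ε` on
  -- the leading part and by `4 / 3` on the tail.
  have hfac : 1 / (1 - ε / 4) ≤ 1 + ε := by
    rw [div_le_iff₀ (by linarith)]; nlinarith
  have hfac' : 1 / (1 - ε / 4) ≤ 4 / 3 := by
    rw [div_le_iff₀ (by linarith)]; linarith
  have hupper : (∑ i, y i) / ‖y‖ ≤ S / b₁ + ε * (S / b₁) + 4 / 3 * (R / b₁) := by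
    rw [hsplit]
    calc (Y + R') / ‖y‖ ≤ (S + R) / (b₁ * (1 - ε / 4)) := by gcongr; exact add_nonneg hS0 (hR0.trans hR)
      _ = S / b₁ * (1 / (1 - ε / 4)) + R / b₁ * (1 / (1 - ε / 4)) := by
        rw [← add_mul, ← add_div, div_mul_div_comm, mul_one]
      _ ≤ S / b₁ * (1 + ε) + R / b₁ * (4 / 3) := by
        have := div_nonneg hS0 hb₁.le
        have := div_nonneg (hR0.trans hR) hb₁.le
        gcongr
      _ = _ := by ring
  have hlower : S / b₁ - ε * (S / b₁) ≤ (∑ i, y i) / ‖y‖ := by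
    rw [hsplit]
    have h0 := div_nonneg hS0 hb₁.le
    calc S / b₁ - ε * (S / b₁) ≤ S * (1 - ε / 4) / b₁ := by
          rw [mul_div_right_comm]; nlinarith
      _ ≤ (Y + R') / ‖y‖ := by gcongr; linarith
  have hRb : 0 ≤ R / b₁ := div_nonneg (hR0.trans hR) hb₁.le
  rw [abs_le]
  constructor <;> linarith

/-! ### Bounds for the tail of the spectrum -/

/-- Uses `3 N - 2 ≥ 2 N` for `N ≥ 2`. -/
lemma mul_le_half_of_lt {N : ℕ} (hN : 2 ≤ N) {η z : ℝ} (hz : 0 ≤ z)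
    (h : η * ((3 * (N : ℝ) - 2) * z) < 1) (hη : 0 < η) : η * N * z ≤ 1 / 2 := by
  have hN0 : (2 : ℝ) ≤ N := by exact_mod_cast hN
  have : 0 ≤ η * z := by positivity
  nlinarith

/-- Gradient descent started at `α` stays between `0` and the larger one of `α` and the fixed
point. -/
lemma scalarGD_nonneg_and_pow_le {N : ℕ} (hN : 2 ≤ N) {lam η α : ℝ} (hη : 0 < η) (hα : 0 < α)
    (hαη : η * N * (α ^ (N - 1)) ^ 2 ≤ 1 / 2)
    (hlam : η * N * |lam| ^ (2 - 2 / (N : ℝ)) ≤ 1 / 2) (k : ℕ) :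
    0 ≤ scalarGD N lam η α k ∧ scalarGD N lam η α k ^ N ≤ max (α ^ N) lam := by
  have hN0 : (2 : ℝ) ≤ N := by exact_mod_cast hN
  rw [rpow_two_sub hN (abs_nonneg _)] at hlam
  set s := |lam| ^ (1 / (N : ℝ)) with hs_def
  have hs : 0 ≤ s := Real.rpow_nonneg (abs_nonneg _) _
  have hsN : s ^ N = |lam| := rpow_one_div_pow hN (abs_nonneg _)
  rcases le_or_gt 0 lam with h0 | h0
  · rw [abs_of_nonneg h0] at hsN
    rw [← hsN]
    rcases le_total α s with h | h
    · have := scalarGD_of_le hη.le hα.le h (by linarith) k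
      have h1 := hα.le.trans this.1
      exact ⟨h1, le_max_of_le_right (by gcongr; exact this.2)⟩
    · have := scalarGD_of_ge hη.le hs h (by linarith) k
      have h1 := hs.trans this.1
      exact ⟨h1, le_max_of_le_left (by gcongr; exact this.2)⟩
  · have hsN' : -lam = s ^ N := by rw [hsN, abs_of_neg h0]
    -- Applied with `x` the larger of `α` and `s`; both summands are then at most `x ^ (2 N - 2)`,
    -- and `2 ≤ N`.
    have key : ∀ x : ℝ, 0 ≤ x → α ≤ x → s ≤ x → η * N * (x ^ (N - 1)) ^ 2 ≤ 1 / 2 →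
        η * (α ^ (N - 2) * (α ^ N - lam)) ≤ 1 := fun x hx h1 h2 h3 => by
      rw [sub_eq_add_neg, hsN']
      have h4 : η * (α ^ (N - 2) * (α ^ N + s ^ N)) ≤ η * (x ^ (N - 2) * (x ^ N + x ^ N)) := by
        gcongr
      have h5 : x ^ (N - 2) * x ^ N = (x ^ (N - 1)) ^ 2 := by
        rw [← pow_add, ← pow_mul]; congr 1; omega
      have h6 : η * (x ^ (N - 2) * (x ^ N + x ^ N)) = η * 2 * (x ^ (N - 1)) ^ 2 := by
        rw [← h5]; ring
      have h7 : η * 2 * (x ^ (N - 1)) ^ 2 ≤ η * N * (x ^ (N - 1)) ^ 2 := by gcongr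
      linarith
    have hneg : η * (α ^ (N - 2) * (α ^ N - lam)) ≤ 1 := by
      rcases le_total α s with h | h
      · exact key s hs h le_rfl hlam
      · exact key α hα.le le_rfl h hαη
    have := scalarGD_of_neg hN hη.le hα.le h0.le hneg k
    exact ⟨this.1, le_max_of_le_left (pow_le_pow_left₀ this.1 this.2 N)⟩

/-- Up to `windowEnd` gradient descent for a target `lam ≤ lam'` is at most `ε' * lam'`. -/
lemma scalarGD_pow_le_of_le_windowEnd {N : ℕ} (hN : 2 ≤ N) {lam lam' ε' η α : ℝ} (hη : 0 < η)
    (hα : 0 < α) (hαη : η * N * (α ^ (N - 1)) ^ 2 ≤ 1 / 2)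
    (hlam : η * N * |lam| ^ (2 - 2 / (N : ℝ)) ≤ 1 / 2) (hle : lam ≤ lam')
    (hε'c : ε' ≤ cN N) (hαε : α ^ N ≤ ε' * lam') {k : ℕ} (hk : k ≤ windowEnd N lam' ε' α η) :
    scalarGD N lam η α k ^ N ≤ ε' * lam' := by
  rcases le_or_gt lam (α ^ N) with h | h
  · exact (scalarGD_nonneg_and_pow_le hN hη hα hαη hlam k).2.trans (by rwa [max_eq_left h])
  have hlam0 : 0 < lam := (pow_pos hα N).trans h
  rw [abs_of_pos hlam0, rpow_two_sub hN hlam0.le] at hlam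
  set s := lam ^ (1 / (N : ℝ)) with hs_def
  have hs : 0 ≤ s := Real.rpow_nonneg hlam0.le _
  have hsN : s ^ N = lam := rpow_one_div_pow hN hlam0.le
  have hαs : α ≤ s := le_of_pow_le_pow_left₀ (n := N) (by omega) hs (hsN ▸ h.le)
  have hεl : 0 < ε' * lam' := (pow_pos hα N).trans_le hαε
  set μ := (ε' * lam') ^ (1 / (N : ℝ)) with hμ_def
  have hμ : 0 ≤ μ := Real.rpow_nonneg hεl.le _
  have hμN : μ ^ N = ε' * lam' := rpow_one_div_pow hN hεl.le
  have hmono := scalarGD_monotone (N := N) hη.le hα.le hαs (by linarith)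
  have hbd := scalarGD_of_le (N := N) hη.le hα.le hαs (by linarith)
  rw [hsN] at hmono hbd
  -- The velocity increases with the target, so descent for `lam` is compared with the flow for
  -- `lam'`. One window end thus serves the whole tail.
  have hstep : ∀ j, scalarGD N lam η α (j + 1)
      ≤ scalarGD N lam η α j + η * velocity N lam' (scalarGD N lam η α j) := fun j => by
    rw [scalarGD_succ]
    have := hα.le.trans (hbd j).1
    unfold velocity
    gcongr
  have := le_of_mul_le_flowTime hN (lam := lam') hα
    (le_of_pow_le_pow_left₀ (n := N) (by omega) hμ (hμN ▸ hαε))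
    (by rw [hμN]; exact mul_le_mul_of_nonneg_right hε'c (hlam0.le.trans hle)) rfl hmono hstep k
    (by
      rw [windowEnd, one_div_mul_eq_div, le_div_iff₀ hη] at hk
      linarith) hη.le
  rw [← hμN]
  have h0 := hα.le.trans (hbd k).1
  gcongr
  exact this.1

end DeepMF

namespace DeepMF

open Matrix

/-! ### Combination of the scalar and the matrix estimates -/

/-- The estimate behind the time window: if gradient descent has passed `windowStart` and the sum of
the non-leading eigenvalues of the iterate is at most `R`, then its effective rank is close to that
of the best rank-`L` approximation. -/
lemma abs_effRank_sub_le_of_windowStart_le {n N L : ℕ} (hN : 2 ≤ N) (hL : 1 ≤ L) (hLn : L ≤ n)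
    {What E Wplus WhatL WplusL : Matrix (Fin n) (Fin n) ℝ} {lam lamt : ℕ → ℝ}
    (hWhat : What.IsSymm) (hE : E.IsSymm) (hWplus : Wplus.IsSymm)
    (hlam : HasSpectrum What lam) (hlam_nonneg : ∀ i ∈ Set.Icc 1 n, 0 ≤ lam i)
    (hlam_one : 0 < lam 1) (hlamt : HasSpectrum (What + E) lamt)
    (hlamp : HasSpectrum Wplus (fun i => max (lamt i) 0))
    (hWhatL : IsBestRankApprox L What WhatL) (hWplusL : IsBestRankApprox L Wplus WplusL)
    {ε α η : ℝ} (hε : ε ∈ Set.Ioo (0 : ℝ) 1) (hα : 0 < α) (hη : 0 < η)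
    (hαη : η * N * (α ^ (N - 1)) ^ 2 ≤ 1 / 2)
    (hη_le : ∀ i : Fin n, η * N * |lamt (i + 1)| ^ (2 - 2 / (N : ℝ)) ≤ 1 / 2)
    (hαl : α ^ N ≤ cN N * max (lamt L) 0) {k : ℕ}
    (hk : windowStart N L (fun i => max (lamt i) 0) ε α η ≤ k) {R : ℝ}
    (hR : ∑ i : Fin n, (if (i : ℕ) < L then 0 else scalarGD N (lamt (i + 1)) η α k ^ N) ≤ R) :
    |effRank WhatL - effRank (gdProd N (What + E) η α k)| ≤
      2 * (L : ℝ) * (specNorm E / lam 1) + ε * effRank WplusL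
        + 4 / 3 * (R / max (lamt 1) 0) := by
  have hc := cN_pos hN
  have hn : 0 < n := by omega
  set b : Fin n → ℝ := fun i => max (lamt (i + 1)) 0 with hb_def
  have hb0 : ∀ i, 0 ≤ b i := fun i => le_max_right _ _
  have hbanti : Antitone b := hlamp.antitone
  have hbl : ∀ i : Fin n, (i : ℕ) < L → α ^ N ≤ cN N * b i := fun i hi => by
    refine hαl.trans ?_
    have := hbanti (show i ≤ ⟨L - 1, by omega⟩ by rw [Fin.le_def]; simp only; omega)
    simp only [hb_def, Nat.sub_add_cancel hL] at this
    gcongr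
  have hbpos : ∀ i : Fin n, (i : ℕ) < L → 0 < b i := fun i hi =>
    pos_of_mul_pos_right ((pow_pos hα N).trans_le (hbl i hi)) hc.le
  have hb₁ : 0 < b ⟨0, hn⟩ := hbpos _ hL
  have hble : ∀ i, b i ≤ b ⟨0, hn⟩ := fun i => hbanti (Nat.zero_le _)
  obtain ⟨U, hU, hUA⟩ := hlamt.exists_diagonal (hWhat.add hE)
  have hWL := effRank_of_isBestRankApprox hL hLn hWhat hlam
    (fun i => hlam_nonneg _ ⟨by omega, by omega⟩) hlam_one hWhatL
  have hWp := effRank_of_isBestRankApprox hL hLn hWplus hlamp hb0 hb₁ hWplusL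
  have hweyl : ∀ i : Fin n, |b i - lam (i + 1)| ≤ specNorm E := fun i => by
    have h1 := abs_sub_le_specNorm hWhat hE hlam hlamt i
    refine le_trans ?_ h1
    -- The positive part is 1-Lipschitz and fixes the nonnegative `lam (i + 1)`, so Weyl's bound
    -- survives truncation.
    have h2 := abs_max_sub_max_le_abs (lamt (i + 1)) (lam (i + 1)) 0
    rwa [max_eq_left (hlam_nonneg (i + 1) ⟨by omega, by omega⟩)] at h2
  have hpert := abs_ratio_sub_ratio_le hLn (a := fun i => lam (i + 1)) (b := b) hlam_one hb₁ hb0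
    hble hweyl (hweyl ⟨0, hn⟩)
  set y : Fin n → ℝ := fun i => scalarGD N (lamt (i + 1)) η α k ^ N with hy_def
  have hsc : ∀ i : Fin n, 0 ≤ scalarGD N (lamt (i + 1)) η α k ∧ y i ≤ max (α ^ N) (lamt (i + 1)) :=
    fun i => scalarGD_nonneg_and_pow_le hN hη hα hαη (hη_le i) k
  have hαb : ∀ i : Fin n, (i : ℕ) < L → α ^ N ≤ b i := fun i hi => (hbl i hi).trans (by
    nlinarith [cN_lt hN, hb0 i])
  have hyb : ∀ i : Fin n, y i ≤ max (α ^ N) (b i) := fun i =>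
    (hsc i).2.trans (max_le_max le_rfl (le_max_left _ _))
  have hlow : ∀ i : Fin n, (i : ℕ) < L → b i * (1 - ε / 4) ≤ y i := fun i hi => by
    have hpos := hbpos i hi
    have hbi : b i = lamt (i + 1) := max_eq_left (by
      by_contra h; exact hpos.ne' (max_eq_right (not_le.1 h).le))
    have h1 := hη_le i
    rw [← hbi, abs_of_pos hpos] at h1
    have h2 := le_scalarGD_of_TId_le hN hα hη hε (hbl i hi) h1 (k := k) (by
      refine le_trans ?_ ((le_max_right _ _).trans hk)
      exact le_ciSup (f := fun l : Fin L => TId N (max (lamt (l + 1)) 0)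
        (max (lamt (l + 1)) 0 ^ (1 / (N : ℝ)) / (4 * (N : ℝ)) * ε) α η)
        (Set.finite_range _).bddAbove ⟨i, hi⟩)
    rw [hbi] at h2 ⊢
    exact h2
  have hrank : effRank (gdProd N (What + E) η α k) = effRank (diagonal y) := by
    rw [hUA, gdProd_conj_diagonal hU, effRank_conj hU]
  have hmain := abs_ratio_sub_effRank_diagonal_le hn hL hε hb₁ (fun i => pow_nonneg (hsc i).1 N)
    (fun i => (hyb i).trans (max_le (hαb ⟨0, hn⟩ hL) (hble i))) hlow
    (fun i hi => (hyb i).trans (max_le (hαb i hi) le_rfl)) hR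
  rw [hrank, hWL, hWp]
  calc _ ≤ _ := abs_sub_le _ ((∑ i : Fin n, if (i : ℕ) < L then b i else 0) / b ⟨0, hn⟩) _
    _ ≤ _ := add_le_add hpert hmain
    _ = _ := by simp only [hb_def, zero_add, add_assoc]

/-- The bound at the largest eigenvalue covers all nonnegative ones and, because `α ^ N ≤ λ̃_1`,
also the initial value. -/
lemma mul_half_le_of_step_bounds {n N : ℕ} (hN : 2 ≤ N) (hn : 1 ≤ n) {lamt : ℕ → ℝ}
    (hanti : AntitoneOn lamt (Set.Icc 1 n)) {α η : ℝ} (hα : 0 < α) (hη : 0 < η)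
    (hα₁ : α ^ N ≤ max (lamt 1) 0)
    (hη_top : η < 1 / ((3 * (N : ℝ) - 2) *
      max (α ^ (N - 2)) (max (lamt 1) 0 ^ (2 - 2 / (N : ℝ)))))
    (hη_neg : ∀ i ∈ Set.Icc 1 n, lamt i < 0 →
      η < 1 / ((3 * (N : ℝ) - 2) * |lamt i| ^ (2 - 2 / (N : ℝ)))) :
    η * N * (α ^ (N - 1)) ^ 2 ≤ 1 / 2 ∧
      ∀ i : Fin n, η * N * |lamt (i + 1)| ^ (2 - 2 / (N : ℝ)) ≤ 1 / 2 := by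
  have hN0 : (2 : ℝ) ≤ N := by exact_mod_cast hN
  have hN3 : 0 < 3 * (N : ℝ) - 2 := by linarith
  have h₁ : 0 < max (lamt 1) 0 := (pow_pos hα N).trans_le hα₁
  have hexp : 0 ≤ 2 - 2 / (N : ℝ) := by
    rw [sub_nonneg, div_le_iff₀ (by linarith)]; linarith
  have htop : η * N * max (lamt 1) 0 ^ (2 - 2 / (N : ℝ)) ≤ 1 / 2 := by
    refine mul_le_half_of_lt hN (Real.rpow_nonneg h₁.le _) ?_ hη
    have hm : 0 < max (α ^ (N - 2)) (max (lamt 1) 0 ^ (2 - 2 / (N : ℝ))) :=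
      lt_max_of_lt_left (pow_pos hα _)
    rw [lt_div_iff₀ (by positivity)] at hη_top
    refine lt_of_le_of_lt ?_ hη_top
    gcongr
    exact le_max_right _ _
  constructor
  · rw [rpow_two_sub hN h₁.le] at htop
    refine le_trans ?_ htop
    have : α ≤ max (lamt 1) 0 ^ (1 / (N : ℝ)) :=
      le_of_pow_le_pow_left₀ (n := N) (by omega) (Real.rpow_nonneg h₁.le _)
        (by rwa [rpow_one_div_pow hN h₁.le])
    gcongr
  · intro i
    have hi : (i + 1 : ℕ) ∈ Set.Icc 1 n := ⟨by omega, by omega⟩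
    rcases le_or_gt 0 (lamt (i + 1)) with h | h
    · rw [abs_of_nonneg h]
      refine le_trans ?_ htop
      have : lamt (i + 1) ≤ max (lamt 1) 0 :=
        (hanti ⟨le_rfl, hn⟩ hi hi.1).trans (le_max_left _ _)
      gcongr
    · have h1 := hη_neg _ hi h
      have h2 : 0 < |lamt (i + 1)| ^ (2 - 2 / (N : ℝ)) := Real.rpow_pos_of_pos (abs_pos.2 h.ne) _
      rw [lt_div_iff₀ (by positivity)] at h1
      exact mul_le_half_of_lt hN h2.le h1 hη

end DeepMF

theorem theorem5p1 (n N L : ℕ) (hN : 2 ≤ N) (hL : 1 ≤ L) (hLn : L ≤ n)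
    -- the target, the noise, the perturbed target and its positive part, with their spectra
    (What E Wplus : Matrix (Fin n) (Fin n) ℝ) (lam lamt : ℕ → ℝ)
    (hWhat : What.IsSymm) (hE : E.IsSymm) (hWplus : Wplus.IsSymm)
    (hlam : DeepMF.HasSpectrum What lam) (hlam_nonneg : ∀ i ∈ Set.Icc 1 n, 0 ≤ lam i)
    (hlam_one : 0 < lam 1)
    (hlamt : DeepMF.HasSpectrum (What + E) lamt)
    (hlamp : DeepMF.HasSpectrum Wplus (fun i => max (lamt i) 0))
    (hlamt_L : 0 < max (lamt L) 0)
    -- best rank-`L` approximations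
    (WhatL WplusL : Matrix (Fin n) (Fin n) ℝ)
    (hWhatL : DeepMF.IsBestRankApprox L What WhatL)
    (hWplusL : DeepMF.IsBestRankApprox L Wplus WplusL)
    -- accuracies, initialization, step size
    (ε ε' α η : ℝ) (hε : ε ∈ Set.Ioo (0 : ℝ) 1) (hα : 0 < α) (hη : 0 < η)
    (hη_top : η < 1 / ((3 * (N : ℝ) - 2) *
      max (α ^ (N - 2)) (max (lamt 1) 0 ^ (2 - 2 / (N : ℝ)))))
    (hη_neg : ∀ i ∈ Set.Icc 1 n, lamt i < 0 →
      η < 1 / ((3 * (N : ℝ) - 2) * |lamt i| ^ (2 - 2 / (N : ℝ)))) :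
    -- the general bound
    (ε' ∈ Set.Ioo 0 (DeepMF.cN N) → α ^ N < ε' * max (lamt L) 0 →
      ∀ L' : ℕ, IsGreatest {l : ℕ | l ∈ Set.Icc 1 n ∧ α ^ N < ε' * max (lamt l) 0} L' →
      ∀ k : ℕ, DeepMF.InWindow N n L (fun i => max (lamt i) 0) ε ε' α η k →
        |DeepMF.effRank WhatL - DeepMF.effRank (DeepMF.gdProd N (What + E) η α k)| ≤
          2 * (L : ℝ) * (DeepMF.specNorm E / lam 1) + ε * DeepMF.effRank WplusL
            + 2 * ((L' : ℝ) - L) / DeepMF.cN N * (max (lamt (L + 1)) 0 / max (lamt 1) 0) * ε'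
            + ((n : ℝ) - L') * (2 * α ^ N / (ε' * max (lamt 1) 0))) ∧
    -- the simplified bound for specific `ε'` and `α`
    (L < n → 0 < max (lamt (L + 1)) 0 →
      ε' = DeepMF.cN N * min (max (lamt 1) 0 / max (lamt (L + 1)) 0
        * (ε * DeepMF.effRank WplusL / (2 * ((n : ℝ) - L)))) 1 →
      α = min ((ε' * max (lamt 1) 0) ^ (1 / (N : ℝ))
          * (ε * DeepMF.effRank WplusL / (2 * ((n : ℝ) - L))) ^ (1 / (N : ℝ)))
        ((ε' * max (lamt (L + 1)) 0) ^ (1 / (N : ℝ))) →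
      ∀ k : ℕ, DeepMF.InWindow N n L (fun i => max (lamt i) 0) ε ε' α η k →
        |DeepMF.effRank WhatL - DeepMF.effRank (DeepMF.gdProd N (What + E) η α k)| ≤
          2 * (L : ℝ) * (DeepMF.specNorm E / lam 1) + 3 * (ε * DeepMF.effRank WplusL)) := by
  have hc := DeepMF.cN_pos hN
  have hc2 := DeepMF.cN_lt hN
  have hanti := hlamp.1
  have h₁L : max (lamt L) 0 ≤ max (lamt 1) 0 := hanti ⟨le_rfl, hL.trans hLn⟩ ⟨hL, hLn⟩ hL
  have h₁ : 0 < max (lamt 1) 0 := hlamt_L.trans_le h₁L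
  have hmain := @DeepMF.abs_effRank_sub_le_of_windowStart_le n N L hN hL hLn What E Wplus WhatL
    WplusL lam lamt hWhat hE hWplus hlam hlam_nonneg hlam_one hlamt hlamp hWhatL hWplusL ε α η hε hα
    hη
  constructor
  · rintro ⟨hε'0, hε'c⟩ hαL L' ⟨⟨hL'n, hL'α⟩, hL'max⟩ k ⟨hk0, hk1⟩
    have hαc : α ^ N ≤ DeepMF.cN N * max (lamt L) 0 := hαL.le.trans (by gcongr)
    have hα₁ : α ^ N ≤ max (lamt 1) 0 := hαc.trans (by nlinarith)
    obtain ⟨hαη, hη_le⟩ := DeepMF.mul_half_le_of_step_bounds hN (hL.trans hLn) hlamt.1 hα hη hα₁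
      hη_top hη_neg
    have hLL' : L ≤ L' := hL'max ⟨⟨hL, hLn⟩, hαL⟩
    set B := ε' * max (lamt (L + 1)) 0 with hB
    set C := α ^ N / ε' with hC
    -- The cases `i < L`, `L ≤ i < L'`, `L' ≤ i` have bounds `0`, `B`, `C`; written with indicators
    -- they sum to `(L' - L) B + (n - L') C`. If `L = n`, then `lamt (L + 1)` is arbitrary, but `L'
    -- = L` and `B` cancels.
    have htail : ∀ i : Fin n, (if (i : ℕ) < L then 0 else
        DeepMF.scalarGD N (lamt (i + 1)) η α k ^ N)
        ≤ C + (if (i : ℕ) < L' then B - C else 0) - (if (i : ℕ) < L then B else 0) := fun i => by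
      by_cases hi : (i : ℕ) < L
      · have h0 : 0 ≤ B := by positivity
        rw [if_pos hi, if_pos hi, if_pos (hi.trans_le hLL')]; linarith
      rw [if_neg hi, if_neg hi, sub_zero]
      by_cases hi' : (i : ℕ) < L'
      · rw [if_pos hi', add_sub_cancel]
        have hle : max (lamt L') 0 ≤ max (lamt (L + 1)) 0 :=
          hanti ⟨by omega, by omega⟩ hL'n (by omega)
        have hαB : α ^ N < B := hL'α.trans_le (by rw [hB]; gcongr)
        refine DeepMF.scalarGD_pow_le_of_le_windowEnd hN hη hα hαη (hη_le i) ?_ hε'c.le hαB.le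
          (hk1 (by omega) ?_)
        · exact (hlamt.1 ⟨by omega, by omega⟩ ⟨by omega, by omega⟩ (by omega)).trans
            (le_max_left _ _)
        · have : 0 ≤ max (lamt (L + 1)) 0 := le_max_right _ _
          exact hαB.trans_le (by rw [hB]; nlinarith)
      · rw [if_neg hi', add_zero]
        -- Beyond `L'`, maximality gives `ε' λ ≤ α ^ N`, so both `α ^ N` and the eigenvalue are at
        -- most `C = α ^ N / ε'`.
        refine (DeepMF.scalarGD_nonneg_and_pow_le hN hη hα hαη (hη_le i) k).2.trans (max_le ?_ ?_)
        · rw [hC, le_div_iff₀ hε'0]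
          have := pow_pos hα N
          nlinarith
        · rw [hC, le_div_iff₀ hε'0]
          have h2 : ¬ α ^ N < ε' * max (lamt (i + 1)) 0 := fun h => by
            have := hL'max ⟨⟨by omega, by omega⟩, h⟩
            omega
          have h3 : ε' * lamt (i + 1) ≤ ε' * max (lamt (i + 1)) 0 := by
            gcongr; exact le_max_left _ _
          linarith
    have hR := Finset.sum_le_sum fun i (_ : i ∈ Finset.univ) => htail i
    rw [Finset.sum_sub_distrib, Finset.sum_add_distrib, DeepMF.sum_ite_lt hL'n.2,
      DeepMF.sum_ite_lt hLn, Finset.sum_const, Finset.card_univ, Fintype.card_fin,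
      nsmul_eq_mul] at hR
    refine (hmain hαη hη_le hαc hk0 hR).trans ?_
    have hL1 : (0 : ℝ) ≤ (L' : ℝ) - L := sub_nonneg.2 (by exact_mod_cast hLL')
    have hL2 : (0 : ℝ) ≤ (n : ℝ) - L' := sub_nonneg.2 (by exact_mod_cast hL'n.2)
    have e1 : 4 / 3 * ((n * C + L' * (B - C) - L * B) / max (lamt 1) 0)
        = 4 / 3 * (((L' : ℝ) - L) * (max (lamt (L + 1)) 0 / max (lamt 1) 0) * ε')
          + 4 / 3 * (((n : ℝ) - L') * (α ^ N / (ε' * max (lamt 1) 0))) := by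
      rw [hB, hC]; field_simp; ring
    have t1 : 0 ≤ ((L' : ℝ) - L) * (max (lamt (L + 1)) 0 / max (lamt 1) 0) * ε' := by positivity
    have t2 : 0 ≤ ((n : ℝ) - L') * (α ^ N / (ε' * max (lamt 1) 0)) := by positivity
    have e2 : 2 * ((L' : ℝ) - L) / DeepMF.cN N * (max (lamt (L + 1)) 0 / max (lamt 1) 0) * ε'
        = 2 / DeepMF.cN N * (((L' : ℝ) - L) * (max (lamt (L + 1)) 0 / max (lamt 1) 0) * ε') := by
      ring
    have e3 : ((n : ℝ) - L') * (2 * α ^ N / (ε' * max (lamt 1) 0))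
        = 2 * (((n : ℝ) - L') * (α ^ N / (ε' * max (lamt 1) 0))) := by ring
    have h43 : 4 / 3 ≤ 2 / DeepMF.cN N := by
      rw [le_div_iff₀ hc]; linarith
    rw [e1, e2, e3]
    have := mul_le_mul_of_nonneg_right h43 t1
    linarith
  · intro hLn' hnext hε' hα' k ⟨hk0, hk1⟩
    have hWp := DeepMF.effRank_of_isBestRankApprox hL hLn hWplus hlamp (fun i => le_max_right _ _) h₁
      hWplusL
    have hr : 0 < DeepMF.effRank WplusL := by
      rw [hWp]
      refine div_pos (Finset.sum_pos' (fun i _ => ?_) ⟨⟨0, by omega⟩, Finset.mem_univ _, ?_⟩) h₁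
      · split_ifs
        exacts [le_max_right _ _, le_rfl]
      · exact h₁.trans_eq (if_pos (show 0 < L from hL)).symm
    set r := DeepMF.effRank WplusL with hr_def
    have hε0 := hε.1
    have hnL : (0 : ℝ) < (n : ℝ) - L := sub_pos.2 (by exact_mod_cast hLn')
    set q := ε * r / (2 * ((n : ℝ) - L)) with hq
    have hq0 : 0 < q := by positivity
    set l₁ := max (lamt 1) 0 with hl₁
    set l' := max (lamt (L + 1)) 0 with hl'
    have hmin : 0 < min (l₁ / l' * q) 1 := lt_min (by positivity) one_pos
    have hε'0 : 0 < ε' := by rw [hε']; positivity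
    -- Equality can occur, so this part does not follow from the first one; every tail entry is
    -- instead bounded by `ε' * l'` directly.
    have hε'c : ε' ≤ DeepMF.cN N := by
      rw [hε']; exact mul_le_of_le_one_right hc.le (min_le_right _ _)
    have hε'q : ε' * l' ≤ DeepMF.cN N * (l₁ * q) := by
      have h2 : ε' ≤ DeepMF.cN N * (l₁ / l' * q) := by
        rw [hε']; gcongr; exact min_le_left _ _
      calc ε' * l' ≤ DeepMF.cN N * (l₁ / l' * q) * l' := by gcongr
        _ = _ := by field_simp
    have hαε : α ^ N ≤ ε' * l' := by
      rw [← DeepMF.rpow_one_div_pow hN (by positivity : 0 ≤ ε' * l')]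
      refine pow_le_pow_left₀ hα.le ?_ N
      rw [hα']; exact min_le_right _ _
    have hl'L : l' ≤ max (lamt L) 0 := hanti ⟨hL, hLn⟩ ⟨by omega, by omega⟩ (by omega)
    have hαc : α ^ N ≤ DeepMF.cN N * max (lamt L) 0 := hαε.trans (by gcongr)
    have hα₁ : α ^ N ≤ l₁ := hαc.trans (by nlinarith)
    obtain ⟨hαη, hη_le⟩ := DeepMF.mul_half_le_of_step_bounds hN (hL.trans hLn) hlamt.1 hα hη hα₁
      hη_top hη_neg
    have htail : ∀ i : Fin n, (if (i : ℕ) < L then 0 else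
        DeepMF.scalarGD N (lamt (i + 1)) η α k ^ N)
        ≤ ε' * l' - (if (i : ℕ) < L then ε' * l' else 0) := fun i => by
      by_cases hi : (i : ℕ) < L
      · rw [if_pos hi, if_pos hi, sub_self]
      rw [if_neg hi, if_neg hi, sub_zero]
      refine DeepMF.scalarGD_pow_le_of_le_windowEnd hN hη hα hαη (hη_le i) ?_ hε'c hαε
        (hk1 hLn' ?_)
      · exact (hlamt.1 ⟨by omega, by omega⟩ ⟨by omega, by omega⟩ (by omega)).trans
          (le_max_left _ _)
      · exact hαε.trans_lt (mul_lt_of_lt_one_left hnext (by linarith))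
    have hR := Finset.sum_le_sum fun i (_ : i ∈ Finset.univ) => htail i
    rw [Finset.sum_sub_distrib, DeepMF.sum_ite_lt hLn, Finset.sum_const, Finset.card_univ,
      Fintype.card_fin, nsmul_eq_mul] at hR
    refine (hmain hαη hη_le hαc hk0 hR).trans ?_
    -- The choice of `ε'` bounds the whole tail, relative to `l₁`, by `c_N ε r / 2`; after the
    -- factor `4 / 3` it costs at most `ε r / 3`.
    have h4 : (n * (ε' * l') - L * (ε' * l')) / l₁ ≤ DeepMF.cN N * (ε * r / 2) := by
      rw [div_le_iff₀ h₁, ← sub_mul]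
      calc ((n : ℝ) - L) * (ε' * l') ≤ ((n : ℝ) - L) * (DeepMF.cN N * (l₁ * q)) := by gcongr
        _ = _ := by rw [hq]; field_simp
    have h5 : DeepMF.cN N * (ε * r / 2) ≤ 1 / 2 * (ε * r / 2) := by gcongr
    have h6 : 0 < ε * r := by positivity
    linarith
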